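/- **The system.** Let $d,r\in\mathbf N$. Fix constants $\lambda_k>0$, $p_k,\,q_{k,l,m},\,d_k\in[0,1]$ ($k,l,m\in\mathbf Z^d$) and $C_f,C_b\ge 0$ such that, with $q_k=\sum_{l,m}q_{k,l,m}$, one has $p_k+q_k+d_k=1$ for all $k$, and $p_k\to0$, $q_k\to 0$ as $|k|\to\infty$. Let $B_{k,l,m}:\mathbf C^r\times\mathbf C^r\to\mathbf C^r$ be bilinear with $|B_{k,l,m}(x,y)|\le|x||y|$. Let $\chi(0)=(\chi_k(0))_{k\in\mathbf Z^d}$ be a family in $\mathbf C^r$, and let $\gamma_k:[0,\infty)\to\mathbf C^r$, $k\in\mathbf Z^d$, be measurable. Let $T\ge0$. A mild solution on $[0,T]$ of $$\dot\chi_k=\lambda_k\Big[-\chi_k+C_fp_k\chi_k+C_b\sum_{l,m}q_{k,l,m}B_{k,l,m}(\chi_l,\chi_m)+d_k\gamma_k\Big],\qquad k\in\mathbf Z^d, \tag{1}$$ is a family of measurable functions $\chi_k:[0,T]\to\mathbf C^r$ such that for every $k$ the series $\sum_{l,m}C_bq_{k,l,m}B_{k,l,m}(\chi_l(s),\chi_m(s))$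 converges absolutely for almost every $s\in[0,T]$, the function $F_k=C_fp_k\chi_k+\sum_{l,m}C_bq_{k,l,m}B_{k,l,m}(\chi_l,\chi_m)+d_k\gamma_k$ is integrable on $[0,T]$, and $$\chi_k(t)=e^{-\lambda_kt}\chi_k(0)+\int_0^t\lambda_ke^{-\lambda_k(t-s)}F_k(s)\,ds\qquad\text{for all }t\in[0,T].$$ The comparison equation is the system (1) for non-negative real functions $\tilde\chi_k$ in which $\chi_k(0),\gamma_k$ are replaced by $|\chi_k(0)|,|\gamma_k|$ and $B_{k,l,m}(x,y)$ by $xy$; its mild solutions are defined in the same way. **The branching tree.** Let $\mathscr I=\bigcup_{n\ge0}\{0,1,2\}^n$. Take independent, identically distributed marks, indexed by $\alpha\in\mathscr I$, each consisting of an exponential variable $E_\alpha$ of mean one, a uniform variable $U_\alpha$ on $[0,1]$ and pairs $(Y^{(1)}_\alpha(k),Y^{(2)}_\alpha(k))$, $k\in\mathbf Z^d$, with $P[Y^{(1)}_\alpha(k)=l,Y^{(2)}_\alpha(k)=m]=q_{k,l,m}/q_k$ if $q_k>0$ (and any law on $\mathbf Z^d\times\mathbf Z^d$ if $q_k=0$),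 all independent. For a root $k$ put $\hat K_\emptyset=k$, $\tau^B_\emptyset=0$, $\tau^D_\emptyset=\lambda_k^{-1}E_\emptyset$ and, for $\alpha\in\mathscr I$, $i\in\{0,1,2\}$, $$\hat K_{(\alpha,0)}=\hat K_\alpha,\quad \hat K_{(\alpha,i)}=Y^{(i)}_\alpha(\hat K_\alpha)\ (i=1,2),\quad \tau^B_{(\alpha,i)}=\tau^D_\alpha,\quad \tau^D_{(\alpha,i)}=\tau^B_{(\alpha,i)}+\lambda^{-1}_{\hat K_{(\alpha,i)}}E_{(\alpha,i)}.$$ The root survives; $(\alpha,0)$ survives iff $\alpha$ does and $U_\alpha\in[0,p_{\hat K_\alpha}]$; for $i=1,2$, $(\alpha,i)$ survives iff $\alpha$ does and $U_\alpha\in[1-q_{\hat K_\alpha},1]$. Put $K_\alpha=\hat K_\alpha$ if $\alpha$ survives and $K_\alpha=\Delta$ (a cemetery state) otherwise. Let $\mathsf P_k$ be the law of the tree $(K_\alpha,\tau^B_\alpha,\tau^D_\alpha)_{\alpha\in\mathscr I}$, and $\mathsf E_k$ its expectation. **Evaluation.** For a tree $\mathcal T=(k_\alpha,s_\alpha,t_\alpha)_\alpha$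 let $\pi_i\mathcal T=(k_{(i,\alpha)},s_{(i,\alpha)}-t_\emptyset,t_{(i,\alpha)}-t_\emptyset)_\alpha$. Then $R_t(\mathcal T)\in\mathbf C^r$ is defined by the recursion $$R_t(\mathcal T)=\begin{cases}\chi_{k_\emptyset}(0)& t_\emptyset\ge t,\\ \gamma_{k_\emptyset}(t-t_\emptyset)& t_\emptyset<t,\ k_{(0)}=k_{(1)}=k_{(2)}=\Delta,\\ C_fR_{t-t_\emptyset}(\pi_0\mathcal T)& t_\emptyset<t,\ k_{(0)}\ne\Delta,\ k_{(1)}=k_{(2)}=\Delta,\\ C_bB_{k_\emptyset,k_{(1)},k_{(2)}}\big(R_{t-t_\emptyset}(\pi_1\mathcal T),R_{t-t_\emptyset}(\pi_2\mathcal T)\big)& t_\emptyset<t,\ k_{(0)}=\Delta,\ k_{(1)},k_{(2)}\ne\Delta,\end{cases}$$ which for $\mathsf P_k$-almost every tree ends after finitely many steps; precisely, $R_t(\mathcal T)$ is the eventually constant value, as $n\to\infty$, of this recursion stopped with value $0$ after $n$ generations (and $0$ if there is no such value). Let $\tilde R_t\ge0$ be defined by the same recursion with $|\chi_k(0)|,|\gamma_k|$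 in place of $\chi_k(0),\gamma_k$ and $xy$ in place of $B_{k,l,m}(x,y)$. **Corollary 4.3.** Suppose that either $\mathsf E_k[\tilde R_t]<\infty$ for all $k\in\mathbf Z^d$, $t\in[0,T]$, or the comparison equation has a (finite, non-negative) mild solution on $[0,T]$. Then $R_t$ is $\mathsf P_k$-integrable for all $k\in\mathbf Z^d$ and $t\in[0,T]$, and $\chi_k(t)=\mathsf E_k[R_t]$ is a mild solution of (1) on $[0,T]$. It satisfies $|\chi_k(t)|\le\mathsf E_k[\tilde R_t]$ for all $k$ and $t\in[0,T]$, and it is unique with this property: if $\chi'$ is a mild solution of (1) on $[0,T]$ with $|\chi'_k(t)|\le\mathsf E_k[\tilde R_t]$ for all $k\in\mathbf Z^d$, $t\in[0,T]$, then $\chi'_k(t)=\chi_k(t)$ for all $k\in\mathbf Z^d$, $t\in[0,T]$. -/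

import Mathlib

open MeasureTheory ProbabilityTheory Filter Set
open scoped ENNReal Topology

noncomputable section

namespace BranchingODE

/-- Fourier modes `𝐤 ∈ ℤ^d`. -/
abbrev Mode (d : ℕ) := Fin d → ℤ

/-- The scalar constants of the infinite system
`χ̇_k = λ_k [ -χ_k + C_f p_k χ_k + C_b ∑_{l,m} q_{k,l,m} B_{k,l,m}(χ_l, χ_m) + d_k γ_k ]`,
indexed by `k ∈ ℤ^d`, with the standing assumptions on them. -/
structure Coeffs (d : ℕ) where
  /-- the rates `λ_k` -/
  rate : Mode d → ℝ
  /-- the flipping probabilities `p_k` -/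
  p : Mode d → ℝ
  /-- the branching probabilities `q_{k,l,m}` -/
  q : Mode d → Mode d → Mode d → ℝ
  /-- the death probabilities `d_k` -/
  death : Mode d → ℝ
  /-- the flipping constant `C_f` -/
  Cf : ℝ
  /-- the branching constant `C_b` -/
  Cb : ℝ
  rate_pos : ∀ k, 0 < rate k
  p_mem : ∀ k, p k ∈ Icc (0 : ℝ) 1
  q_mem : ∀ k l m, q k l m ∈ Icc (0 : ℝ) 1
  death_mem : ∀ k, death k ∈ Icc (0 : ℝ) 1
  Cf_nonneg : 0 ≤ Cf
  Cb_nonneg : 0 ≤ Cb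
  q_summable : ∀ k, Summable fun lm : Mode d × Mode d => q k lm.1 lm.2
  sum_eq_one : ∀ k, p k + ∑' lm : Mode d × Mode d, q k lm.1 lm.2 + death k = 1
  /- `|k| → ∞` in `ℤ^d` is convergence along the complements of finite sets. -/
  p_tendsto : Tendsto p cofinite (𝓝 0)
  q_tendsto : Tendsto (fun k => ∑' lm : Mode d × Mode d, q k lm.1 lm.2) cofinite (𝓝 0)

namespace Coeffs

variable {d : ℕ} (S : Coeffs d)

/-- The total branching probability `q_k = ∑_{l,m} q_{k,l,m}`. -/
def qTot (k : Mode d) : ℝ := ∑' lm : Mode d × Mode d, S.q k lm.1 lm.2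

/-! ### Mild solutions -/

section Mild

variable {E : Type*} [NormedAddCommGroup E] [NormedSpace ℝ E]

/-- The bracket
`C_f p_k χ_k(s) + C_b ∑_{l,m} q_{k,l,m} B_{k,l,m}(χ_l(s), χ_m(s)) + d_k γ_k(s)`. -/
def bracket (B : Mode d → Mode d → Mode d → E → E → E) (γ χ : Mode d → ℝ → E)
    (k : Mode d) (s : ℝ) : E :=
  (S.Cf * S.p k) • χ k s
    + ∑' lm : Mode d × Mode d, (S.Cb * S.q k lm.1 lm.2) • B k lm.1 lm.2 (χ lm.1 s) (χ lm.2 s)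
    + S.death k • γ k s

/-- `χ` is a mild solution on `[0, T]` with products `B`, initial condition `χ₀` and forcing `γ`:
each `χ_k` is measurable on `[0, T]`, the sum over `l, m` converges (unconditionally) at almost
every time and the bracket is integrable, so that the mild formulation makes sense, and
`χ_k(t) = e^{-λ_k t} χ₀_k + ∫_0^t λ_k e^{-λ_k (t-s)} [bracket]_k(s) ds` for all `k` and
all `t ∈ [0, T]`. -/
structure IsMildSolution [MeasurableSpace E] (B : Mode d → Mode d → Mode d → E → E → E)
    (χ₀ : Mode d → E) (γ : Mode d → ℝ → E) (T : ℝ) (χ : Mode d → ℝ → E) : Prop where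
  measurable : ∀ k, Measurable fun t : Icc (0 : ℝ) T => χ k t
  summable : ∀ k, ∀ᵐ s ∂(volume.restrict (Icc (0 : ℝ) T)),
    Summable fun lm : Mode d × Mode d =>
      (S.Cb * S.q k lm.1 lm.2) • B k lm.1 lm.2 (χ lm.1 s) (χ lm.2 s)
  integrable : ∀ k, IntegrableOn (S.bracket B γ χ k) (Icc (0 : ℝ) T)
  mild : ∀ k, ∀ t ∈ Icc (0 : ℝ) T,
    χ k t = Real.exp (-(S.rate k * t)) • χ₀ k
      + ∫ s in (0 : ℝ)..t, (S.rate k * Real.exp (-(S.rate k * (t - s)))) • S.bracket B γ χ k s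

/-- `X` is a finite mild solution on `[0, T]` of the comparison equation: a nonnegative real mild
solution of the system with the data `|χ₀_k|`, `|γ_k|` and with every `B_{k,l,m}` replaced by the
product of real numbers. -/
def IsComparisonSolution (χ₀ : Mode d → E) (γ : Mode d → ℝ → E) (T : ℝ)
    (X : Mode d → ℝ → ℝ) : Prop :=
  (∀ k, ∀ t ∈ Icc (0 : ℝ) T, 0 ≤ X k t) ∧
    S.IsMildSolution (fun _ _ _ x y : _ => x * y) (fun k => ‖χ₀ k‖) (fun k s => ‖γ k s‖) T X

end Mild

end Coeffs

/-! ### Labels and trees -/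

/-- Particle labels `α ∈ ⋃ₙ {0,1,2}ⁿ`, **stored with the last generation first**:
`(α₁, …, αₙ)` is the list `[αₙ, …, α₁]`. So the parent `α|ₙ₋₁` of `α` is the tail, the label
`(α, i)` is `i :: α`, and the label `(i, α)` is `α ++ [i]`. -/
abbrev Label := List (Fin 3)

/-- A position in `ℤ^d`, or the cemetery `Δ`, which is `none`. -/
abbrev Site (d : ℕ) := Option (Mode d)

instance (d : ℕ) : MeasurableSpace (Site d) := ⊤

/-- The space of trees `(k_α, s_α, t_α)_α` of positions, birth times and death times,
with the product σ-algebra. -/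
abbrev Tree (d : ℕ) := Label → Site d × ℝ × ℝ

namespace Tree

variable {d : ℕ}

/-- The position `k_α`. -/
def pos (𝒯 : Tree d) (α : Label) : Site d := (𝒯 α).1

/-- The birth time `s_α`. -/
def birth (𝒯 : Tree d) (α : Label) : ℝ := (𝒯 α).2.1

/-- The death time `t_α`. -/
def deathTime (𝒯 : Tree d) (α : Label) : ℝ := (𝒯 α).2.2

/-- The shift `π_i`: the tree of descendants of the particle `(i)`, with time restarted at the
death time `t_∅` of the root. -/
def shift (i : Fin 3) (𝒯 : Tree d) : Tree d := fun α =>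
  (𝒯.pos (α ++ [i]), 𝒯.birth (α ++ [i]) - 𝒯.deathTime [], 𝒯.deathTime (α ++ [i]) - 𝒯.deathTime [])

end Tree

/-! ### The branching process and its law -/

namespace Coeffs

variable {d : ℕ} (S : Coeffs d)

lemma tsum_ofReal_q_ne_top (k : Mode d) :
    (∑' lm : Mode d × Mode d, ENNReal.ofReal (S.q k lm.1 lm.2)) ≠ ∞ :=
  (S.q_summable k).tsum_ofReal_ne_top

/-- The joint law of the positions `(Y¹(k), Y²(k))` of the two offspring of a particle branching at
`k`: the pair `(l, m)` has probability `q_{k,l,m} / q_k`. If `q_k = 0` no branching occurs and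
the law is irrelevant. -/
def offspring (k : Mode d) : PMF (Mode d × Mode d) :=
  open Classical in
  if h : (∑' lm : Mode d × Mode d, ENNReal.ofReal (S.q k lm.1 lm.2)) = 0 then PMF.pure (0, 0)
  else PMF.normalize (fun lm => ENNReal.ofReal (S.q k lm.1 lm.2)) h (S.tsum_ofReal_q_ne_top k)

end Coeffs

/-- The randomness `(E_α, U_α, (Y¹_α(k), Y²_α(k))_k)` attached to one label. -/
abbrev Mark (d : ℕ) := ℝ × unitInterval × (Mode d → Mode d × Mode d)

namespace Coeffs

variable {d : ℕ} (S : Coeffs d)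

/-- The law of the randomness of one label: `E` is exponential with mean one, `U` is uniform on
`[0,1]`, `(Y¹(k), Y²(k))` has law `offspring k`, and all of these are independent. -/
def markLaw : Measure (Mark d) :=
  (expMeasure 1).prod ((volume : Measure unitInterval).prod
    (Measure.infinitePi fun k => (S.offspring k).toMeasure))

instance : IsProbabilityMeasure S.markLaw := by
  have : IsProbabilityMeasure (expMeasure 1) := isProbabilityMeasure_expMeasure one_pos
  unfold markLaw
  infer_instance

/-- The law of the family of all marks, i.i.d. over the labels. -/
def noiseLaw : Measure (Label → Mark d) := Measure.infinitePi fun _ => S.markLaw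

instance : IsProbabilityMeasure S.noiseLaw := by
  unfold noiseLaw
  infer_instance

/-- The position `K̂_α` in the complete tree rooted at `k`. A child labelled `0` stays at the
position of its parent; the children labelled `1` and `2` are placed according to the two
components of the offspring pair of the parent. -/
def fullPos (k : Mode d) (ω : Label → Mark d) : Label → Mode d
  | [] => k
  | i :: α =>
    if i = 0 then fullPos k ω α
    else if i = 1 then ((ω α).2.2 (fullPos k ω α)).1
    else ((ω α).2.2 (fullPos k ω α)).2

/-- The death time `τ^D_α`: a particle at `K̂_α` lives for the time `λ_{K̂_α}⁻¹ E_α`. -/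
def tauD (k : Mode d) (ω : Label → Mark d) : Label → ℝ
  | [] => (S.rate k)⁻¹ * (ω []).1
  | i :: α => tauD k ω α + (S.rate (fullPos k ω (i :: α)))⁻¹ * (ω (i :: α)).1

/-- The birth time `τ^B_α`: zero for the root, otherwise the death time of the parent. -/
def tauB (k : Mode d) (ω : Label → Mark d) : Label → ℝ
  | [] => 0
  | _ :: α => S.tauD k ω α

/-- The particle `α` is really present: at each of its ancestors `β`, the uniform variable `U_β`
chose the right event, a flip if `U_β ∈ [0, p]` and a branching if `U_β ∈ [1 - q, 1]`,
where `p`, `q` are taken at the position of `β`. -/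
def Survives (k : Mode d) (ω : Label → Mark d) : Label → Prop
  | [] => True
  | i :: α => Survives k ω α ∧
      if i = 0 then ((ω α).2.1 : ℝ) ∈ Icc 0 (S.p (fullPos k ω α))
      else ((ω α).2.1 : ℝ) ∈ Icc (1 - S.qTot (fullPos k ω α)) 1

/-- The branching tree `𝒯_k` rooted at `k`, as a function of the marks. -/
def branchingTree (k : Mode d) (ω : Label → Mark d) : Tree d := fun α =>
  open Classical in
  (if S.Survives k ω α then some (fullPos k ω α) else none, S.tauB k ω α, S.tauD k ω α)

/-- `𝖯_k`, the law of the branching tree rooted at `k`. -/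
def treeLaw (k : Mode d) : Measure (Tree d) := S.noiseLaw.map (S.branchingTree k)

lemma measurable_fullPos (k : Mode d) (α : Label) :
    Measurable fun ω : Label → Mark d => fullPos k ω α := by
  induction α with
  | nil => exact measurable_const
  | cons i α ih =>
    have h : Measurable fun ω : Label → Mark d => (ω α).2.2 (fullPos k ω α) := by
      refine measurable_to_countable' fun y => ?_
      have : (fun ω : Label → Mark d => (ω α).2.2 (fullPos k ω α)) ⁻¹' {y}
          = ⋃ x : Mode d, {ω | fullPos k ω α = x} ∩ {ω | (ω α).2.2 x = y} := by
        ext ω; simp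
      rw [this]
      refine MeasurableSet.iUnion fun x => ?_
      have h2 : Measurable fun ω : Label → Mark d => (ω α).2.2 x := by fun_prop
      exact (ih (measurableSet_singleton x)).inter (h2 (measurableSet_singleton y))
    simp only [fullPos]
    split_ifs
    · exact ih
    · exact h.fst
    · exact h.snd

lemma measurable_tauD (k : Mode d) (α : Label) :
    Measurable fun ω : Label → Mark d => S.tauD k ω α := by
  induction α with
  | nil => simp only [tauD]; fun_prop
  | cons i α ih =>
    simp only [tauD]
    have h : Measurable fun ω : Label → Mark d => (S.rate (fullPos k ω (i :: α)))⁻¹ :=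
      (measurable_from_top (f := fun x => (S.rate x)⁻¹)).comp
        ((measurable_fullPos k (i :: α)).mono le_rfl (fun s _ => s.to_countable.measurableSet))
    fun_prop

lemma measurableSet_survives (k : Mode d) (α : Label) :
    MeasurableSet {ω : Label → Mark d | S.Survives k ω α} := by
  induction α with
  | nil => simp [Survives]
  | cons i α ih =>
    have hc : ∀ f : Mode d → ℝ, Measurable fun ω : Label → Mark d => f (fullPos k ω α) := fun f =>
      (measurable_from_top (f := f)).comp
        ((measurable_fullPos k α).mono le_rfl (fun s _ => s.to_countable.measurableSet))
    have hU : Measurable fun ω : Label → Mark d => ((ω α).2.1 : ℝ) := by fun_prop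
    have h1 : MeasurableSet {ω : Label → Mark d |
        ((ω α).2.1 : ℝ) ∈ Icc 0 (S.p (fullPos k ω α))} :=
      (measurableSet_le measurable_const hU).inter (measurableSet_le hU (hc S.p))
    have h2 : MeasurableSet {ω : Label → Mark d |
        ((ω α).2.1 : ℝ) ∈ Icc (1 - S.qTot (fullPos k ω α)) 1} :=
      (measurableSet_le (measurable_const.sub (hc S.qTot)) hU).inter
        (measurableSet_le hU measurable_const)
    by_cases h : i = 0
    · simp only [Survives, if_pos h]
      exact ih.inter h1
    · simp only [Survives, if_neg h]
      exact ih.inter h2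

/-- The branching tree is a random variable, so that `treeLaw` is indeed its law. -/
lemma measurable_branchingTree (k : Mode d) : Measurable (S.branchingTree k) := by
  classical
  refine measurable_pi_lambda _ fun α => ?_
  refine Measurable.prodMk ?_ (Measurable.prodMk ?_ (S.measurable_tauD k α))
  · refine Measurable.ite (S.measurableSet_survives k α) ?_ measurable_const
    exact (measurable_from_top (f := fun x : Mode d => (some x : Site d))).comp
        ((measurable_fullPos k α).mono le_rfl (fun s _ => s.to_countable.measurableSet))
  · cases α with
    | nil => exact measurable_const
    | cons i α => exact S.measurable_tauD k α

instance (k : Mode d) : IsProbabilityMeasure (S.treeLaw k) :=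
  Measure.isProbabilityMeasure_map (S.measurable_branchingTree k).aemeasurable

/-! ### Evaluation along the tree -/

section Evaluation

variable {E : Type*} [NormedAddCommGroup E] [NormedSpace ℝ E]

/-- The evaluation of a tree at time `t` along its first `n` generations. With `t_∅` the death time
of the root it is `χ₀_k` if `t ≤ t_∅`, where `k` is the position of the root; otherwise
`γ_k(t - t_∅)` at a death, `C_f R(π₀ 𝒯)` at a flip and `C_b B_{k,l,m}(R(π₁ 𝒯), R(π₂ 𝒯))` at a
branching into `l, m`, the subtrees being evaluated at time `t - t_∅` along `n - 1` generations.
It is `0` if the generations do not suffice, or if the root is not a particle with one of the three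
possible events. -/
def evalApprox (B : Mode d → Mode d → Mode d → E → E → E) (χ₀ : Mode d → E)
    (γ : Mode d → ℝ → E) : ℕ → ℝ → Tree d → E
  | 0, _, _ => 0
  | n + 1, t, 𝒯 =>
    match 𝒯.pos [] with
    | none => 0
    | some k =>
      open Classical in
      if t ≤ 𝒯.deathTime [] then χ₀ k
      else
        match 𝒯.pos [0], 𝒯.pos [1], 𝒯.pos [2] with
        | none, none, none => γ k (t - 𝒯.deathTime [])
        | some _, none, none =>
            S.Cf • evalApprox B χ₀ γ n (t - 𝒯.deathTime []) (𝒯.shift 0)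
        | none, some l, some m =>
            S.Cb • B k l m (evalApprox B χ₀ γ n (t - 𝒯.deathTime []) (𝒯.shift 1))
              (evalApprox B χ₀ γ n (t - 𝒯.deathTime []) (𝒯.shift 2))
        | _, _, _ => 0

/-- The evaluation map `R_t`: the value at which the evaluations along the first `n` generations
become stationary as `n` grows (almost every tree has finitely many particles born by time `t`,
and then they do). It is `0` if they do not. -/
def eval (B : Mode d → Mode d → Mode d → E → E → E) (χ₀ : Mode d → E)
    (γ : Mode d → ℝ → E) (t : ℝ) (𝒯 : Tree d) : E :=
  open Classical in
  if h : ∃ n, ∀ m, n ≤ m → S.evalApprox B χ₀ γ m t 𝒯 = S.evalApprox B χ₀ γ n t 𝒯 then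
    S.evalApprox B χ₀ γ h.choose t 𝒯
  else 0

/-- The comparison evaluation `R̃_t`: the evaluation with the data `|χ₀_k|`, `|γ_k|` and with the
product of real numbers in place of every `B_{k,l,m}`. It is nonnegative. -/
def evalComparison (χ₀ : Mode d → E) (γ : Mode d → ℝ → E) (t : ℝ) (𝒯 : Tree d) : ℝ :=
  S.eval (fun _ _ _ x y : _ => x * y) (fun k => ‖χ₀ k‖) (fun k s => ‖γ k s‖) t 𝒯

/-- `𝖤_k[R̃_t] ∈ [0, ∞]`. -/
def comparisonExpectation (χ₀ : Mode d → E) (γ : Mode d → ℝ → E) (k : Mode d) (t : ℝ) : ℝ≥0∞ :=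
  ∫⁻ 𝒯, ENNReal.ofReal (S.evalComparison χ₀ γ t 𝒯) ∂(S.treeLaw k)

/-- `𝖤_k[R_t]`, meaningful when `R_t` is integrable under `𝖯_k`. -/
def expectation (B : Mode d → Mode d → Mode d → E → E → E) (χ₀ : Mode d → E)
    (γ : Mode d → ℝ → E) (k : Mode d) (t : ℝ) : E :=
  ∫ 𝒯, S.eval B χ₀ γ t 𝒯 ∂(S.treeLaw k)

end Evaluation

end Coeffs

end BranchingODE

end

noncomputable section

namespace BranchingODE

/-! ### Independence of the root and its three subtrees -/

section Split

variable {A B M : Type*} [MeasurableSpace M]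

/-! Stopping the evaluation after `n` generations, with value zero beyond, turns expectations over
the tree into Picard iterates of the mild equation started from zero. Write Y_n for the expectations
of the stopped evaluation (`mean`), N_n for those of the stopped comparison evaluation (`normMean`),
and M for the supremum of the N_n (`normMeanLimit`). Splitting the tree at the death of the root
makes the lifetime, the event and the subtrees independent (`map_firstStep`). The expectation of a
product over two subtrees therefore factors, so that N_{n+1} and Y_{n+1} are the images of N_n and
Y_n under the mild maps (`lmean_succ`, `mean_succ`).

Almost every tree ends. Because p and q tend to zero, a suitable exponential weight in time makes
the expected number of children contract by 1/2 per generation, and the probability that `n`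
generations do not suffice is at most e^{θt} 2^{-n} (`one_le_finishedMean_add`). Hence M is the
expectation of the comparison evaluation (`iSup_normMean`). Induction on `n` shows that N_n lies
below any mild solution of the comparison equation, so both alternative hypotheses give M < ∞
(`normMeanLimit_le_of_comparisonSolution`).

No contraction estimate is available for the equation itself. Its place is taken by the gap
inequality |Z - Y_n| + N_n ≤ M. If it holds for a family Z bounded by M, then it holds with n + 1
for the image of Z under the mild map, since |B(z,z') - B(y,y')| ≤ (M - N)M' + N(M' - N') = MM' -
NN' (`enorm_bracket_sub_add_le`, `enorm_mild_sub_mean_add_le`). As N_n increases to M < ∞, a family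
that satisfies all the gap inequalities is the limit of Y_n (`tendsto_mean_of_enorm_sub_add_le`).
The expectation and its image under the mild map both satisfy them, hence agree: this is existence.
A mild solution bounded by M satisfies them too: this is uniqueness. -/

lemma infinitePi_map_sum (μ : A ⊕ B → Measure M) [∀ i, IsProbabilityMeasure (μ i)] :
    (Measure.infinitePi μ).map (fun ω => (fun a => ω (Sum.inl a), fun b => ω (Sum.inr b)))
      = (Measure.infinitePi fun a => μ (Sum.inl a)).prod
          (Measure.infinitePi fun b => μ (Sum.inr b)) := by
  have hm : Measurable fun x : (A → M) × (B → M) => (Sum.elim x.1 x.2 : A ⊕ B → M) := by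
    refine measurable_pi_lambda _ fun i => ?_
    cases i <;> simp only [Sum.elim_inl, Sum.elim_inr] <;> fun_prop
  -- It is easier to glue than to split: the glued product measure has the right mass on
  -- finite-dimensional boxes, which determines it, and gluing inverts splitting.
  have h : ((Measure.infinitePi fun a => μ (Sum.inl a)).prod
      (Measure.infinitePi fun b => μ (Sum.inr b))).map (fun x => Sum.elim x.1 x.2)
        = Measure.infinitePi μ := by
    refine Measure.eq_infinitePi _ fun s t ht => ?_
    rw [Measure.map_apply hm (.pi s.countable_toSet fun i _ => ht i)]
    have : (fun x : (A → M) × (B → M) => (Sum.elim x.1 x.2 : A ⊕ B → M)) ⁻¹' ((s : Set _).pi t)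
        = ((s.toLeft : Set A).pi fun a => t (Sum.inl a)) ×ˢ
          ((s.toRight : Set B).pi fun b => t (Sum.inr b)) := by
      ext x; simp [Set.mem_pi]
    rw [this, Measure.prod_prod, Measure.infinitePi_pi _ (fun i _ => ht _),
      Measure.infinitePi_pi _ (fun i _ => ht _)]
    conv_rhs => rw [← Finset.toLeft_disjSum_toRight (u := s), Finset.prod_disjSum]
  rw [← h, Measure.map_map (by fun_prop) hm]
  convert! Measure.map_id

end Split

/-- The label of a particle is either the root label or a label seen from one of the three
children of the root. -/
def labelEquiv : Unit ⊕ (Label ⊕ (Label ⊕ Label)) ≃ Label :=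
  Equiv.ofBijective
    (Sum.elim (fun _ => []) (Sum.elim (· ++ [0]) (Sum.elim (· ++ [1]) (· ++ [2])))) <| by
  constructor
  · rintro (_ | a | a | a) (_ | b | b | b) h <;> simp_all
  · intro α
    rcases List.eq_nil_or_concat α with rfl | ⟨β, i, rfl⟩
    · exact ⟨Sum.inl (), rfl⟩
    · fin_cases i
      · exact ⟨Sum.inr (Sum.inl β), by simp⟩
      · exact ⟨Sum.inr (Sum.inr (Sum.inl β)), by simp⟩
      · exact ⟨Sum.inr (Sum.inr (Sum.inr β)), by simp⟩

variable {d : ℕ}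

instance : MeasurableSpace (Mark d) := Prod.instMeasurableSpace

instance : MeasurableSpace (Label → Mark d) := MeasurableSpace.pi

/-- The marks seen from the child `i` of the root. -/
def childNoise (i : Fin 3) (ω : Label → Mark d) : Label → Mark d := fun α => ω (α ++ [i])

lemma measurable_childNoise (i : Fin 3) : Measurable (childNoise i : (Label → Mark d) → _) := by
  unfold childNoise; fun_prop

namespace Coeffs

variable (S : Coeffs d)

/-- Three independent copies of the noise. -/
def noiseLaw₃ : Measure ((Label → Mark d) × (Label → Mark d) × (Label → Mark d)) :=
  S.noiseLaw.prod (S.noiseLaw.prod S.noiseLaw)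

instance : IsProbabilityMeasure S.noiseLaw₃ := by unfold noiseLaw₃; infer_instance

/-- Relabelling along the bijection `labelEquiv` preserves an i.i.d. family; the index set is then a
nested disjoint union, and each of its three sums yields a product of measures. -/
lemma map_noiseLaw_split :
    S.noiseLaw.map (fun ω => (ω [], childNoise 0 ω, childNoise 1 ω, childNoise 2 ω))
      = S.markLaw.prod S.noiseLaw₃ := by
  have h0 : S.noiseLaw.map (fun ω i => ω (labelEquiv i))
      = Measure.infinitePi fun _ : Unit ⊕ (Label ⊕ (Label ⊕ Label)) => S.markLaw :=
    Measure.map_infinitePi_infinitePi_of_inj (P := fun _ : Label => S.markLaw)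
      labelEquiv.injective
  have h1 := infinitePi_map_sum fun _ : Unit ⊕ (Label ⊕ (Label ⊕ Label)) => S.markLaw
  have h2 := infinitePi_map_sum fun _ : Label ⊕ (Label ⊕ Label) => S.markLaw
  have h3 := infinitePi_map_sum fun _ : Label ⊕ Label => S.markLaw
  have h4 : (Measure.infinitePi fun _ : Unit => S.markLaw).map (fun x => x ()) = S.markLaw :=
    Measure.infinitePi_map_eval _ _
  have hF : ∀ A B : Type, Measurable (fun x : A ⊕ B → Mark d =>
      ((fun a => x (Sum.inl a), fun b => x (Sum.inr b)) : (A → Mark d) × (B → Mark d))) := by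
    intro A B; fun_prop
  have e : (fun ω : Label → Mark d => (ω [], childNoise 0 ω, childNoise 1 ω, childNoise 2 ω))
    = (Prod.map (fun x : Unit → Mark d => x ()) (Prod.map id
        fun x : Label ⊕ Label → Mark d => (fun a => x (Sum.inl a), fun a => x (Sum.inr a)))) ∘
      (Prod.map id fun x : Label ⊕ (Label ⊕ Label) → Mark d =>
        (fun a => x (Sum.inl a), fun a => x (Sum.inr a))) ∘
      (fun x : Unit ⊕ (Label ⊕ (Label ⊕ Label)) → Mark d =>
        (fun a => x (Sum.inl a), fun a => x (Sum.inr a))) ∘ (fun ω i => ω (labelEquiv i)) := rfl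
  have m1 := hF Unit (Label ⊕ (Label ⊕ Label))
  have m2 := hF Label (Label ⊕ Label)
  have m3 := hF Label Label
  have m0 : Measurable fun (ω : Label → Mark d) i => ω (labelEquiv i) := by fun_prop
  have i : Measurable (id : (Label → Mark d) → _) := measurable_id
  have n3 := i.prodMap m3
  have j : Measurable (id : (Unit → Mark d) → _) := measurable_id
  have n2 := j.prodMap m2
  have n4 : Measurable fun x : Unit → Mark d => x () := by fun_prop
  rw [e, ← Measure.map_map (n4.prodMap n3) (n2.comp (m1.comp m0)),
    ← Measure.map_map n2 (m1.comp m0), ← Measure.map_map m1 m0, h0, h1,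
    ← Measure.map_prod_map _ _ measurable_id m2, h2, ← Measure.map_prod_map _ _ n4 n3,
    Measure.map_id, h4,
    ← Measure.map_prod_map _ _ measurable_id m3, h3, Measure.map_id]
  rfl

end Coeffs

/-! ### The event at the death of a particle -/

/-- What happens to a particle at its death. -/
inductive Event (d : ℕ)
  | death
  | flip
  | branch (lm : Mode d × Mode d)

namespace Event

instance : MeasurableSpace (Event d) := ⊤

instance : DiscreteMeasurableSpace (Event d) := ⟨fun _ => trivial⟩

instance : Countable (Event d) := by
  refine Function.Injective.countable (β := Option (Option (Mode d × Mode d)))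
    (f := fun e => match e with
      | death => none
      | flip => some none
      | branch lm => some (some lm)) ?_
  rintro (_ | _ | _) (_ | _ | _) h <;> simp_all

end Event

namespace Coeffs

variable (S : Coeffs d)

lemma qTot_nonneg (k : Mode d) : 0 ≤ S.qTot k := tsum_nonneg fun lm => (S.q_mem k lm.1 lm.2).1

lemma sum_eq_one' (k : Mode d) : S.p k + S.qTot k + S.death k = 1 := S.sum_eq_one k

lemma ofReal_qTot (k : Mode d) :
    ENNReal.ofReal (S.qTot k) = ∑' lm : Mode d × Mode d, ENNReal.ofReal (S.q k lm.1 lm.2) :=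
  ENNReal.ofReal_tsum_of_nonneg (fun lm => (S.q_mem k lm.1 lm.2).1) (S.q_summable k)

/-- The product is insensitive to the arbitrary offspring law chosen when the total branching
probability is zero: both sides then vanish. -/
lemma ofReal_qTot_mul_offspring (k : Mode d) (lm : Mode d × Mode d) :
    ENNReal.ofReal (S.qTot k) * S.offspring k lm = ENNReal.ofReal (S.q k lm.1 lm.2) := by
  rw [ofReal_qTot, offspring]
  split_ifs with h
  · rw [h, zero_mul]
    exact ((ENNReal.tsum_eq_zero.1 h) lm).symm
  · rw [PMF.normalize_apply, mul_comm, mul_assoc,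
      ENNReal.inv_mul_cancel h (S.tsum_ofReal_q_ne_top k), mul_one]

open Classical in
/-- The event decided by a uniform variable and a pair of offspring positions. -/
def event (k : Mode d) (u : unitInterval) (y : Mode d × Mode d) : Event d :=
  if (u : ℝ) < S.p k then .flip else if 1 - S.qTot k ≤ (u : ℝ) then .branch y else .death

lemma measurable_event (k : Mode d) :
    Measurable fun x : unitInterval × (Mode d × Mode d) => S.event k x.1 x.2 := by
  classical
  unfold event
  refine Measurable.ite ?_ measurable_const (Measurable.ite ?_ ?_ measurable_const)
  · exact measurableSet_lt (by fun_prop) measurable_const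
  · exact measurableSet_le measurable_const (by fun_prop)
  · exact (measurable_of_countable (Event.branch (d := d))).comp measurable_snd

/-- The law of the event at the death of a particle at `k`. -/
def eventLaw (k : Mode d) : Measure (Event d) :=
  ENNReal.ofReal (S.death k) • Measure.dirac .death + ENNReal.ofReal (S.p k) • Measure.dirac .flip
    + Measure.sum fun lm : Mode d × Mode d =>
      ENNReal.ofReal (S.q k lm.1 lm.2) • Measure.dirac (.branch lm)

/-- The unit interval is cut at p and at 1 - q, in this order because the death probability 1 - p -
q is nonnegative. Events are countable, so masses of single events suffice. -/
lemma map_event (k : Mode d) :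
    (((volume : Measure unitInterval).prod
      (Measure.infinitePi fun k => (S.offspring k).toMeasure)).map
        fun x => S.event k x.1 (x.2 k)) = S.eventLaw k := by
  classical
  have hp := S.p_mem k
  have hd := S.death_mem k
  have hq := S.qTot_nonneg k
  have h1 := S.sum_eq_one' k
  have e : (fun x : unitInterval × (Mode d → Mode d × Mode d) => S.event k x.1 (x.2 k))
      = (fun x : unitInterval × (Mode d × Mode d) => S.event k x.1 x.2) ∘
        Prod.map id (fun y => y k) := rfl
  rw [e, ← Measure.map_map (S.measurable_event k) (measurable_id.prodMap (by fun_prop)),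
    ← Measure.map_prod_map _ _ measurable_id (by fun_prop), Measure.infinitePi_map_eval,
    Measure.map_id]
  refine Measure.ext_of_singleton fun a => ?_
  rw [Measure.map_apply (S.measurable_event k) (measurableSet_singleton a)]
  let up : unitInterval := ⟨S.p k, hp⟩
  let uq : unitInterval := ⟨1 - S.qTot k, by constructor <;> linarith [hp.1, hd.1]⟩
  have hle : up ≤ uq := by
    change S.p k ≤ 1 - S.qTot k
    linarith [hd.1]
  cases a with
  | death =>
    have : (fun x : unitInterval × (Mode d × Mode d) => S.event k x.1 x.2) ⁻¹' {.death}
        = Ico up uq ×ˢ univ := by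
      ext x
      simp only [event, mem_preimage, mem_singleton_iff, mem_prod, mem_Ico, mem_univ, and_true]
      change _ ↔ S.p k ≤ (x.1 : ℝ) ∧ (x.1 : ℝ) < 1 - S.qTot k
      split_ifs <;> simp_all [lt_sub_iff_add_lt]
    rw [this, Measure.prod_prod, unitInterval.volume_Ico]
    simp [eventLaw, up, uq]
    congr 1; linarith
  | flip =>
    have : (fun x : unitInterval × (Mode d × Mode d) => S.event k x.1 x.2) ⁻¹' {.flip}
        = Iio up ×ˢ univ := by
      ext x
      simp only [event, mem_preimage, mem_singleton_iff, mem_prod, mem_Iio, mem_univ, and_true]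
      change _ ↔ (x.1 : ℝ) < S.p k
      split_ifs <;> simp_all
    rw [this, Measure.prod_prod, unitInterval.volume_Iio]
    simp [eventLaw, up]
  | branch lm =>
    have : (fun x : unitInterval × (Mode d × Mode d) => S.event k x.1 x.2) ⁻¹' {.branch lm}
        = Ici uq ×ˢ {lm} := by
      ext x
      simp only [event, mem_preimage, mem_singleton_iff, mem_prod, mem_Ici]
      change _ ↔ 1 - S.qTot k ≤ (x.1 : ℝ) ∧ _
      have : S.p k ≤ 1 - S.qTot k := hle
      split_ifs
      · simp; intro h; linarith
      · simp_all
      · simp_all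
    rw [this, Measure.prod_prod, unitInterval.volume_Ici,
      PMF.toMeasure_apply_singleton _ _ (measurableSet_singleton _)]
    have h2 : (1 : ℝ) - uq = S.qTot k := by simp [uq]
    rw [h2, ofReal_qTot_mul_offspring]
    simp [eventLaw, Measure.sum_apply]
    rw [tsum_eq_single lm]
    · simp
    · intro b hb; simp [hb]

instance (k : Mode d) : IsProbabilityMeasure (S.eventLaw k) := by
  rw [← map_event]
  refine Measure.isProbabilityMeasure_map (Measurable.aemeasurable ?_)
  have : Measurable fun x : unitInterval × (Mode d → Mode d × Mode d) => (x.1, x.2 k) := by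
    fun_prop
  exact (S.measurable_event k).comp this

end Coeffs

/-! ### Lifetimes and the first-step decomposition -/

lemma map_expMeasure_one {r : ℝ} (hr : 0 < r) :
    (expMeasure 1).map (fun x => r⁻¹ * x) = expMeasure r := by
  have i1 := isProbabilityMeasure_expMeasure one_pos
  have i2 := isProbabilityMeasure_expMeasure hr
  have hm : Measurable fun x : ℝ => r⁻¹ * x := by fun_prop
  have i3 := Measure.isProbabilityMeasure_map (μ := expMeasure 1) hm.aemeasurable
  refine Measure.eq_of_cdf _ _ ?_
  ext x
  rw [cdf_expMeasure_eq hr, cdf_eq_real, measureReal_def, Measure.map_apply hm measurableSet_Iic]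
  have : (fun x => r⁻¹ * x) ⁻¹' Iic x = Iic (r * x) := by
    ext y; simp [inv_mul_le_iff₀ hr]
  rw [this, ← measureReal_def, ← cdf_eq_real, cdf_expMeasure_eq one_pos]
  simp [mul_nonneg_iff_of_pos_left hr]

namespace Coeffs

variable (S : Coeffs d)

/-- The law of the lifetime of a particle at `k`. -/
def lifeLaw (k : Mode d) : Measure ℝ := expMeasure (S.rate k)

instance (k : Mode d) : IsProbabilityMeasure (S.lifeLaw k) :=
  isProbabilityMeasure_expMeasure (S.rate_pos k)

/-- The lifetime of the root, the event at its death, and the marks seen from its children. -/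
abbrev _root_.BranchingODE.FirstStep (d : ℕ) :=
  ℝ × Event d × (Label → Mark d) × (Label → Mark d) × (Label → Mark d)

/-- The first step of the branching tree rooted at `k`. -/
def firstStep (k : Mode d) (ω : Label → Mark d) :
    FirstStep d :=
  ((S.rate k)⁻¹ * (ω []).1, S.event k (ω []).2.1 ((ω []).2.2 k),
    childNoise 0 ω, childNoise 1 ω, childNoise 2 ω)

lemma measurable_firstStep (k : Mode d) : Measurable (S.firstStep k) := by
  refine Measurable.prodMk (by fun_prop) (Measurable.prodMk ?_
    (Measurable.prodMk (measurable_childNoise 0)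
      (Measurable.prodMk (measurable_childNoise 1) (measurable_childNoise 2))))
  exact (S.measurable_event k).comp
    (f := fun ω : Label → Mark d => ((ω []).2.1, (ω []).2.2 k)) (by fun_prop)

/-- This is the branching property: the event uses only the uniform variable and the offspring pair
of the root, the lifetime only its exponential variable, and the subtrees only the marks of their
own labels. -/
lemma map_firstStep (k : Mode d) :
    S.noiseLaw.map (S.firstStep k) = (S.lifeLaw k).prod ((S.eventLaw k).prod S.noiseLaw₃) := by
  have i1 := isProbabilityMeasure_expMeasure one_pos
  have m1 : Measurable fun x : ℝ => (S.rate k)⁻¹ * x := by fun_prop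
  have m2 : Measurable fun x : unitInterval × (Mode d → Mode d × Mode d) =>
      S.event k x.1 (x.2 k) :=
    have : Measurable fun x : unitInterval × (Mode d → Mode d × Mode d) => (x.1, x.2 k) := by
      fun_prop
    (S.measurable_event k).comp this
  have e : S.firstStep k = MeasurableEquiv.prodAssoc ∘
      (Prod.map (Prod.map (fun x : ℝ => (S.rate k)⁻¹ * x)
        fun x : unitInterval × (Mode d → Mode d × Mode d) => S.event k x.1 (x.2 k)) id) ∘
      fun ω => (ω [], childNoise 0 ω, childNoise 1 ω, childNoise 2 ω) := rfl
  have m3 : Measurable fun ω : Label → Mark d =>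
      (ω [], childNoise 0 ω, childNoise 1 ω, childNoise 2 ω) := by
    unfold childNoise; fun_prop
  have m4 := (m1.prodMap m2).prodMap (measurable_id
    (α := (Label → Mark d) × (Label → Mark d) × (Label → Mark d)))
  rw [e, ← Measure.map_map (MeasurableEquiv.measurable _) (m4.comp m3),
    ← Measure.map_map m4 m3, map_noiseLaw_split,
    ← Measure.map_prod_map _ _ (m1.prodMap m2) measurable_id, markLaw,
    ← Measure.map_prod_map _ _ m1 m2, map_event, map_expMeasure_one (S.rate_pos k), Measure.map_id,
    (measurePreserving_prodAssoc _ _ _).map_eq]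
  rfl

lemma lintegral_eventLaw (k : Mode d) (f : Event d → ℝ≥0∞) :
    ∫⁻ e, f e ∂S.eventLaw k = ENNReal.ofReal (S.death k) * f .death
      + ENNReal.ofReal (S.p k) * f .flip
      + ∑' lm : Mode d × Mode d, ENNReal.ofReal (S.q k lm.1 lm.2) * f (.branch lm) := by
  simp [eventLaw, lintegral_sum_measure]

variable {E : Type*} [NormedAddCommGroup E] [NormedSpace ℝ E] [CompleteSpace E]

lemma integral_eventLaw (k : Mode d) {f : Event d → E} (hf : Integrable f (S.eventLaw k)) :
    ∫ e, f e ∂S.eventLaw k = S.death k • f .death + S.p k • f .flip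
      + ∑' lm : Mode d × Mode d, S.q k lm.1 lm.2 • f (.branch lm) := by
  unfold eventLaw at hf ⊢
  obtain ⟨h12, h3⟩ := integrable_add_measure.1 hf
  obtain ⟨h1, h2⟩ := integrable_add_measure.1 h12
  rw [integral_add_measure h12 h3, integral_add_measure h1 h2, integral_sum_measure h3]
  simp only [integral_smul_measure, integral_dirac]
  rw [ENNReal.toReal_ofReal (S.death_mem k).1, ENNReal.toReal_ofReal (S.p_mem k).1]
  congr 1
  exact tsum_congr fun lm => by rw [ENNReal.toReal_ofReal (S.q_mem k _ _).1]

lemma lintegral_firstStep (k : Mode d)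
    {G : FirstStep d → ℝ≥0∞}
    (hG : Measurable G) :
    ∫⁻ ω, G (S.firstStep k ω) ∂S.noiseLaw
      = ∫⁻ s, ∫⁻ e, ∫⁻ w, G (s, e, w) ∂S.noiseLaw₃ ∂S.eventLaw k ∂S.lifeLaw k := by
  rw [← lintegral_map hG (S.measurable_firstStep k), map_firstStep,
    lintegral_prod _ hG.aemeasurable]
  refine lintegral_congr fun s => ?_
  exact lintegral_prod _ (hG.comp measurable_prodMk_left).aemeasurable

lemma integral_firstStep (k : Mode d)
    {G : FirstStep d → E}
    (hG : StronglyMeasurable G) (hi : Integrable (fun ω => G (S.firstStep k ω)) S.noiseLaw) :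
    ∫ ω, G (S.firstStep k ω) ∂S.noiseLaw
      = ∫ s, (S.death k • ∫ w, G (s, .death, w) ∂S.noiseLaw₃
          + S.p k • ∫ w, G (s, .flip, w) ∂S.noiseLaw₃
          + ∑' lm : Mode d × Mode d, S.q k lm.1 lm.2 • ∫ w, G (s, .branch lm, w) ∂S.noiseLaw₃)
        ∂S.lifeLaw k := by
  have hi' := (integrable_map_measure hG.aestronglyMeasurable
    (S.measurable_firstStep k).aemeasurable).2 hi
  rw [← integral_map (S.measurable_firstStep k).aemeasurable hG.aestronglyMeasurable]
  rw [map_firstStep] at hi' ⊢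
  rw [integral_prod _ hi']
  refine integral_congr_ae ?_
  filter_upwards [hi'.prod_right_ae] with s hs
  rw [integral_prod _ hs, integral_eventLaw _ _ hs.integral_prod_left]

/-! ### Self-similarity of the tree under passage to a child -/

lemma fullPos_append (k : Mode d) (ω : Label → Mark d) (i : Fin 3) (α : Label) :
    fullPos k ω (α ++ [i]) = fullPos (fullPos k ω [i]) (childNoise i ω) α := by
  induction α with
  | nil => rfl
  | cons j α ih =>
    simp only [List.cons_append, fullPos] at ih ⊢
    rw [ih]
    rfl

lemma tauD_append (k : Mode d) (ω : Label → Mark d) (i : Fin 3) (α : Label) :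
    S.tauD k ω (α ++ [i]) = S.tauD k ω [] + S.tauD (fullPos k ω [i]) (childNoise i ω) α := by
  induction α with
  | nil => rfl
  | cons j α ih =>
    simp only [List.cons_append, tauD] at ih ⊢
    rw [ih, ← List.cons_append, fullPos_append, add_assoc]
    rfl

lemma survives_append (k : Mode d) (ω : Label → Mark d) (i : Fin 3) (α : Label) :
    S.Survives k ω (α ++ [i]) ↔
      S.Survives k ω [i] ∧ S.Survives (fullPos k ω [i]) (childNoise i ω) α := by
  induction α with
  | nil => simp [Survives]
  | cons j α ih =>
    rw [List.cons_append, Survives, Survives, ih, fullPos_append, and_assoc]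
    rfl

/-- Survival of the child is essential: otherwise its whole subtree sits in the cemetery, whereas
the root of a fresh tree is always alive. -/
lemma shift_branchingTree {k : Mode d} {ω : Label → Mark d} {i : Fin 3}
    (h : S.Survives k ω [i]) :
    (S.branchingTree k ω).shift i = S.branchingTree (fullPos k ω [i]) (childNoise i ω) := by
  funext α
  unfold Tree.shift Tree.pos Tree.birth Tree.deathTime branchingTree
  simp only [fullPos_append, tauD_append, add_sub_cancel_left]
  have : S.tauB k ω (α ++ [i]) - S.tauD k ω [] = S.tauB (fullPos k ω [i]) (childNoise i ω) α := by
    cases α with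
    | nil => simp [tauB]
    | cons j α => simp [tauB, tauD_append]
  have h' : S.Survives k ω (α ++ [i]) ↔ S.Survives (fullPos k ω [i]) (childNoise i ω) α := by
    rw [survives_append, and_iff_right h]
  rw [this]
  by_cases hs : S.Survives k ω (α ++ [i])
  · rw [if_pos hs, if_pos (h'.1 hs)]
  · rw [if_neg hs, if_neg (mt h'.2 hs)]

variable {E : Type*} [NormedAddCommGroup E] [NormedSpace ℝ E]

open Classical in
/-- The evaluation of a tree from its first step, given the evaluations `r` of the subtrees. -/
def stepEval (B : Mode d → Mode d → Mode d → E → E → E) (χ₀ : Mode d → E) (γ : Mode d → ℝ → E)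
    (r : Mode d → ℝ → (Label → Mark d) → E) (k : Mode d) (t : ℝ)
    (x : FirstStep d) : E :=
  if t ≤ x.1 then χ₀ k
  else match x.2.1 with
    | .death => γ k (t - x.1)
    | .flip => S.Cf • r k (t - x.1) x.2.2.1
    | .branch lm =>
      S.Cb • B k lm.1 lm.2 (r lm.1 (t - x.1) x.2.2.2.1) (r lm.2 (t - x.1) x.2.2.2.2)

lemma stepEval_of_le {B : Mode d → Mode d → Mode d → E → E → E} {χ₀ : Mode d → E}
    {γ : Mode d → ℝ → E} {r : Mode d → ℝ → (Label → Mark d) → E} {k : Mode d} {t : ℝ}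
    {x : FirstStep d} (h : t ≤ x.1) : S.stepEval B χ₀ γ r k t x = χ₀ k :=
  if_pos h

lemma stepEval_of_not_le {B : Mode d → Mode d → Mode d → E → E → E} {χ₀ : Mode d → E}
    {γ : Mode d → ℝ → E} {r : Mode d → ℝ → (Label → Mark d) → E} {k : Mode d} {t : ℝ}
    {x : FirstStep d} (h : ¬ t ≤ x.1) : S.stepEval B χ₀ γ r k t x =
      match x.2.1 with
      | .death => γ k (t - x.1)
      | .flip => S.Cf • r k (t - x.1) x.2.2.1
      | .branch lm =>
        S.Cb • B k lm.1 lm.2 (r lm.1 (t - x.1) x.2.2.2.1) (r lm.2 (t - x.1) x.2.2.2.2) :=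
  if_neg h

/-- The evaluation of the branching tree along its first `n` generations. -/
def approxAt (B : Mode d → Mode d → Mode d → E → E → E) (χ₀ : Mode d → E) (γ : Mode d → ℝ → E)
    (n : ℕ) (k : Mode d) (t : ℝ) (ω : Label → Mark d) : E :=
  S.evalApprox B χ₀ γ n t (S.branchingTree k ω)

/-- The excluded value of the uniform variable is the one point where the closed survival interval
for a flip and the strict inequality in `event` disagree. If the death probability is zero, flip and
branching would both take place there. -/
lemma approxAt_succ (B : Mode d → Mode d → Mode d → E → E → E) (χ₀ : Mode d → E)
    (γ : Mode d → ℝ → E) (n : ℕ) (k : Mode d) (t : ℝ) (ω : Label → Mark d)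
    (hω : ((ω []).2.1 : ℝ) ≠ S.p k) :
    S.approxAt B χ₀ γ (n + 1) k t ω
      = S.stepEval B χ₀ γ (S.approxAt B χ₀ γ n) k t (S.firstStep k ω) := by
  classical
  have hd := S.death_mem k
  have h1 := S.sum_eq_one' k
  have hU := (ω []).2.1.2
  have e0 : S.Survives k ω [0] ↔ ((ω []).2.1 : ℝ) < S.p k := by
    simp only [Survives, fullPos, true_and, if_true]
    exact ⟨fun h => lt_of_le_of_ne h.2 hω, fun h => ⟨hU.1, h.le⟩⟩
  have e1 : S.Survives k ω [1] ↔ 1 - S.qTot k ≤ ((ω []).2.1 : ℝ) := by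
    simp [Survives, fullPos, hU.2]
  have e2 : S.Survives k ω [2] ↔ 1 - S.qTot k ≤ ((ω []).2.1 : ℝ) := by
    simp [Survives, fullPos, hU.2]
  have p0 : (S.branchingTree k ω).pos [] = some k := by
    simp [Tree.pos, branchingTree, Survives, fullPos]
  have pd : (S.branchingTree k ω).deathTime [] = (S.rate k)⁻¹ * (ω []).1 := rfl
  have pc : ∀ i, (S.branchingTree k ω).pos [i]
      = if S.Survives k ω [i] then some (fullPos k ω [i]) else none := fun i => rfl
  have sh : ∀ i, S.Survives k ω [i] → (S.branchingTree k ω).shift i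
      = S.branchingTree (fullPos k ω [i]) (childNoise i ω) := fun i => S.shift_branchingTree
  unfold approxAt
  simp only [evalApprox, p0, pd]
  by_cases ht : t ≤ (S.rate k)⁻¹ * (ω []).1
  · rw [if_pos ht, stepEval_of_le S (x := S.firstStep k ω) ht]
  rw [if_neg ht, stepEval_of_not_le S (x := S.firstStep k ω) ht]
  by_cases hp : ((ω []).2.1 : ℝ) < S.p k
  · have hq : ¬ 1 - S.qTot k ≤ ((ω []).2.1 : ℝ) := by push Not; linarith [hd.1]
    rw [pc 0, pc 1, pc 2, if_pos (e0.2 hp), if_neg (mt e1.1 hq), if_neg (mt e2.1 hq)]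
    simp only [firstStep, event, if_pos hp, sh 0 (e0.2 hp)]
    rfl
  · by_cases hq : 1 - S.qTot k ≤ ((ω []).2.1 : ℝ)
    · rw [pc 0, pc 1, pc 2, if_neg (mt e0.1 hp), if_pos (e1.2 hq), if_pos (e2.2 hq)]
      simp only [firstStep, event, if_neg hp, if_pos hq, sh 1 (e1.2 hq), sh 2 (e2.2 hq)]
      rfl
    · rw [pc 0, pc 1, pc 2, if_neg (mt e0.1 hp), if_neg (mt e1.1 hq), if_neg (mt e2.1 hq)]
      simp only [firstStep, event, if_neg hp, if_neg hq]

lemma ae_uniform_ne (x : ℝ) : ∀ᵐ ω ∂S.noiseLaw, ((ω []).2.1 : ℝ) ≠ x := by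
  have i1 := isProbabilityMeasure_expMeasure one_pos
  have h1 : ∀ᵐ u : unitInterval, (u : ℝ) ≠ x := by
    by_cases hx : x ∈ unitInterval
    · have : ∀ᵐ u : unitInterval, u ≠ ⟨x, hx⟩ := by
        rw [ae_iff]
        simp only [not_not, ofPred_eq_eq_singleton]
        rw [← Icc_self, unitInterval.volume_Icc]
        simp
      filter_upwards [this] with u hu h
      exact hu (Subtype.ext h)
    · exact Eventually.of_forall fun u h => hx (h ▸ u.2)
  have h2 : MeasurePreserving (fun ω : Label → Mark d => (ω []).2.1) S.noiseLaw volume :=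
    measurePreserving_fst.comp (measurePreserving_snd.comp
      (measurePreserving_eval_infinitePi (fun _ : Label => S.markLaw) []))
  exact h2.quasiMeasurePreserving.ae h1

lemma approxAt_succ_ae (B : Mode d → Mode d → Mode d → E → E → E) (χ₀ : Mode d → E)
    (γ : Mode d → ℝ → E) (n : ℕ) (k : Mode d) (t : ℝ) :
    S.approxAt B χ₀ γ (n + 1) k t =ᵐ[S.noiseLaw]
      fun ω => S.stepEval B χ₀ γ (S.approxAt B χ₀ γ n) k t (S.firstStep k ω) := by
  filter_upwards [S.ae_uniform_ne (S.p k)] with ω hω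
  exact S.approxAt_succ B χ₀ γ n k t ω hω

/-! ### Measurability of the evaluation -/

section Measurability

variable [MeasurableSpace E] [BorelSpace E]
  {B : Mode d → Mode d → Mode d → E → E → E}
  (hB : ∀ k l m, Measurable fun x : E × E => B k l m x.1 x.2)
  {χ₀ : Mode d → E} {γ : Mode d → ℝ → E} (hγ : ∀ k, Measurable (γ k))

include hB hγ

/-- Joint measurability in time and tree is needed because the recursion evaluates subtrees at a
random remaining time. Sites are countable, so the case distinction can be frozen at fixed sites. -/
lemma measurable_evalApprox (n : ℕ) :
    Measurable fun x : ℝ × Tree d => S.evalApprox B χ₀ γ n x.1 x.2 := by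
  classical
  induction n with
  | zero => exact measurable_const
  | succ n ih =>
    have hd : Measurable fun x : ℝ × Tree d => x.2.deathTime [] := by
      unfold Tree.deathTime; fun_prop
    have hs : ∀ i, Measurable fun x : ℝ × Tree d => x.2.shift i := by
      intro i; unfold Tree.shift Tree.pos Tree.birth Tree.deathTime; fun_prop
    have hr : ∀ i, Measurable fun x : ℝ × Tree d =>
        S.evalApprox B χ₀ γ n (x.1 - x.2.deathTime []) (x.2.shift i) := fun i =>
      ih.comp ((measurable_fst.sub hd).prodMk (hs i))
    have hc : Measurable fun x : ℝ × Tree d =>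
        (x, x.2.pos [], x.2.pos [0], x.2.pos [1], x.2.pos [2]) := by
      unfold Tree.pos; fun_prop
    refine (measurable_from_prod_countable_left (γ := E) (α := ℝ × Tree d)
      (f := fun y : (ℝ × Tree d) × Site d × Site d × Site d × Site d =>
        match y.2.1 with
        | none => 0
        | some k =>
          if y.1.1 ≤ y.1.2.deathTime [] then χ₀ k
          else
            match y.2.2.1, y.2.2.2.1, y.2.2.2.2 with
            | none, none, none => γ k (y.1.1 - y.1.2.deathTime [])
            | some _, none, none =>
                S.Cf • S.evalApprox B χ₀ γ n (y.1.1 - y.1.2.deathTime []) (y.1.2.shift 0)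
            | none, some l, some m =>
                S.Cb • B k l m (S.evalApprox B χ₀ γ n (y.1.1 - y.1.2.deathTime []) (y.1.2.shift 1))
                  (S.evalApprox B χ₀ γ n (y.1.1 - y.1.2.deathTime []) (y.1.2.shift 2))
            | _, _, _ => 0) ?_).comp hc
    rintro ⟨_ | k, c0, c1, c2⟩
    · exact measurable_const
    refine Measurable.ite (measurableSet_le measurable_fst hd) measurable_const ?_
    rcases c0 with _ | _ <;> rcases c1 with _ | l <;> rcases c2 with _ | m
    · exact (hγ k).comp (measurable_fst.sub hd)
    · exact measurable_const
    · exact measurable_const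
    · exact ((hB k l m).comp ((hr 1).prodMk (hr 2))).const_smul S.Cb
    · exact (hr 0).const_smul S.Cf
    · exact measurable_const
    · exact measurable_const
    · exact measurable_const

lemma measurable_approxAt (n : ℕ) (k : Mode d) :
    Measurable fun x : ℝ × (Label → Mark d) => S.approxAt B χ₀ γ n k x.1 x.2 :=
  (S.measurable_evalApprox hB hγ n).comp
    (measurable_fst.prodMk ((S.measurable_branchingTree k).comp measurable_snd))

lemma measurable_stepEval {r : Mode d → ℝ → (Label → Mark d) → E}
    (hr : ∀ k, Measurable fun x : ℝ × (Label → Mark d) => r k x.1 x.2) (k : Mode d) (t : ℝ) :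
    Measurable (S.stepEval B χ₀ γ r k t) := by
  classical
  have hc : Measurable fun x : FirstStep d
      => (x, x.2.1) := by fun_prop
  refine (measurable_from_prod_countable_left (γ := E)
    (f := fun y : FirstStep d × Event d =>
      if t ≤ y.1.1 then χ₀ k
      else match y.2 with
        | .death => γ k (t - y.1.1)
        | .flip => S.Cf • r k (t - y.1.1) y.1.2.2.1
        | .branch lm => S.Cb • B k lm.1 lm.2 (r lm.1 (t - y.1.1) y.1.2.2.2.1)
            (r lm.2 (t - y.1.1) y.1.2.2.2.2)) ?_).comp hc
  intro e
  refine Measurable.ite (measurableSet_le measurable_const measurable_fst) measurable_const ?_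
  cases e with
  | death => exact (hγ k).comp (measurable_const.sub measurable_fst)
  | flip => exact ((hr k).comp (g := fun x : ℝ × (Label → Mark d) => r k x.1 x.2)
      (f := fun y : FirstStep d => (t - y.1, y.2.2.1)) (by fun_prop)).const_smul S.Cf
  | branch lm =>
    refine ((hB k lm.1 lm.2).comp (Measurable.prodMk ?_ ?_)).const_smul S.Cb
    · exact (hr lm.1).comp (f := fun y : FirstStep d => (t - y.1, y.2.2.2.1)) (by fun_prop)
    · exact (hr lm.2).comp (f := fun y : FirstStep d => (t - y.1, y.2.2.2.2)) (by fun_prop)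

end Measurability

/-! ### Tree-by-tree monotonicity and domination -/

section Pointwise

variable {a : Mode d → ℝ} {g : Mode d → ℝ → ℝ}

lemma evalApprox_mul_nonneg (ha : ∀ k, 0 ≤ a k) (hg : ∀ k s, 0 ≤ g k s) (n : ℕ) (t : ℝ)
    (𝒯 : Tree d) : 0 ≤ S.evalApprox (fun _ _ _ x y => x * y) a g n t 𝒯 := by
  induction n generalizing t 𝒯 with
  | zero => exact le_rfl
  | succ n ih =>
    unfold evalApprox
    split
    · exact le_rfl
    split_ifs
    · exact ha _
    split
    · exact hg _ _
    · exact mul_nonneg S.Cf_nonneg (ih _ _)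
    · exact mul_nonneg S.Cb_nonneg (mul_nonneg (ih _ _) (ih _ _))
    · exact le_rfl

/-- The value zero at the cutoff is the least possible one, and the recursion is monotone on
nonnegative values. -/
lemma evalApprox_mul_le_succ (ha : ∀ k, 0 ≤ a k) (hg : ∀ k s, 0 ≤ g k s) (n : ℕ) (t : ℝ)
    (𝒯 : Tree d) : S.evalApprox (fun _ _ _ x y => x * y) a g n t 𝒯
      ≤ S.evalApprox (fun _ _ _ x y => x * y) a g (n + 1) t 𝒯 := by
  induction n generalizing t 𝒯 with
  | zero => exact S.evalApprox_mul_nonneg ha hg _ _ _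
  | succ n ih =>
    rw [evalApprox, evalApprox]
    split
    · exact le_rfl
    split_ifs
    · exact le_rfl
    split
    · exact le_rfl
    · exact mul_le_mul_of_nonneg_left (ih _ _) S.Cf_nonneg
    · exact mul_le_mul_of_nonneg_left (mul_le_mul (ih _ _) (ih _ _)
        (S.evalApprox_mul_nonneg ha hg _ _ _) (S.evalApprox_mul_nonneg ha hg _ _ _)) S.Cb_nonneg
    · exact le_rfl

variable {E : Type*} [NormedAddCommGroup E] [NormedSpace ℝ E]
  {B : Mode d → Mode d → Mode d → E → E → E}

lemma norm_evalApprox_le (hB : ∀ k l m x y, ‖B k l m x y‖ ≤ ‖x‖ * ‖y‖) (χ₀ : Mode d → E)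
    (γ : Mode d → ℝ → E) (n : ℕ) (t : ℝ) (𝒯 : Tree d) :
    ‖S.evalApprox B χ₀ γ n t 𝒯‖
      ≤ S.evalApprox (fun _ _ _ x y => x * y) (fun k => ‖χ₀ k‖) (fun k s => ‖γ k s‖) n t 𝒯 := by
  induction n generalizing t 𝒯 with
  | zero => simp [evalApprox]
  | succ n ih =>
    rw [evalApprox, evalApprox]
    split
    · simp
    split_ifs
    · exact le_rfl
    split
    · exact le_rfl
    · rw [norm_smul, Real.norm_of_nonneg S.Cf_nonneg]
      exact mul_le_mul_of_nonneg_left (ih _ _) S.Cf_nonneg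
    · rw [norm_smul, Real.norm_of_nonneg S.Cb_nonneg]
      refine mul_le_mul_of_nonneg_left ((hB _ _ _ _ _).trans ?_) S.Cb_nonneg
      exact mul_le_mul (ih _ _) (ih _ _) (norm_nonneg _) ((norm_nonneg _).trans (ih _ _))
    · simp

end Pointwise

/-! ### The mild formulation through the lifetime of the root -/

/-- The right-hand side of the mild formulation with values in `[0, ∞]`: the expectation of `c`
if the root survives until `t` and of `F` at the remaining time otherwise. -/
def mildLIntegral (k : Mode d) (c : ℝ≥0∞) (F : ℝ → ℝ≥0∞) (t : ℝ) : ℝ≥0∞ :=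
  open Classical in ∫⁻ s, if t ≤ s then c else F (t - s) ∂S.lifeLaw k

/-- The bracket of the comparison equation with values in `[0, ∞]`. -/
def lbracket (g M : Mode d → ℝ → ℝ≥0∞) (k : Mode d) (s : ℝ) : ℝ≥0∞ :=
  ENNReal.ofReal (S.Cf * S.p k) * M k s
    + ∑' lm : Mode d × Mode d, ENNReal.ofReal (S.Cb * S.q k lm.1 lm.2) * (M lm.1 s * M lm.2 s)
    + ENNReal.ofReal (S.death k) * g k s

/-- The right-hand side of the mild formulation: the expectation of `c` if the root survives
until `t` and of `F` at the remaining time otherwise. -/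
def mildIntegral {E : Type*} [NormedAddCommGroup E] [NormedSpace ℝ E] (k : Mode d) (c : E)
    (F : ℝ → E) (t : ℝ) : E :=
  open Classical in ∫ s, if t ≤ s then c else F (t - s) ∂S.lifeLaw k

lemma ae_lifeLaw_nonneg (k : Mode d) : ∀ᵐ s ∂S.lifeLaw k, 0 ≤ s := by
  rw [ae_iff, lifeLaw, expMeasure, gammaMeasure]
  simp only [not_le]
  change (volume.withDensity _) (Iio 0) = 0
  rw [withDensity_apply _ measurableSet_Iio]
  exact lintegral_gammaPDF_of_nonpos le_rfl

/-- The expectation of the comparison evaluation along the first `n` generations. -/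
def lmean (a : Mode d → ℝ) (g : Mode d → ℝ → ℝ) (n : ℕ) (k : Mode d) (t : ℝ) : ℝ≥0∞ :=
  ∫⁻ ω, ENNReal.ofReal (S.approxAt (fun _ _ _ x y => x * y) a g n k t ω) ∂S.noiseLaw

lemma measurePreserving_noiseLaw₃_fst :
    MeasurePreserving (fun w => w.1) S.noiseLaw₃ S.noiseLaw := measurePreserving_fst

lemma measurePreserving_noiseLaw₃_snd :
    MeasurePreserving (fun w => w.2) S.noiseLaw₃ (S.noiseLaw.prod S.noiseLaw) :=
  measurePreserving_snd

/-- Condition on the first step. At a branching the two subtrees are independent, so the expectation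
of the product factors; with values in `[0, ∞]` no integrability is required. -/
lemma lmean_succ {a : Mode d → ℝ} {g : Mode d → ℝ → ℝ} (ha : ∀ k, 0 ≤ a k)
    (hg : ∀ k s, 0 ≤ g k s) (hgm : ∀ k, Measurable (g k)) (n : ℕ) (k : Mode d) (t : ℝ) :
    S.lmean a g (n + 1) k t
      = S.mildLIntegral k (ENNReal.ofReal (a k))
          (S.lbracket (fun k s => ENNReal.ofReal (g k s)) (S.lmean a g n) k) t := by
  classical
  have hB : ∀ _ _ _ : Mode d, Measurable fun x : ℝ × ℝ => x.1 * x.2 := fun _ _ _ => by fun_prop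
  have hr := S.measurable_approxAt (B := fun _ _ _ x y => x * y) (χ₀ := a) hB hgm n
  have hr' : ∀ k t, Measurable fun ω =>
      ENNReal.ofReal (S.approxAt (fun _ _ _ x y => x * y) a g n k t ω) :=
    fun k t => ((hr k).comp measurable_prodMk_left).ennreal_ofReal
  have h0 : ∀ k t ω, 0 ≤ S.approxAt (fun _ _ _ x y => x * y) a g n k t ω := fun k t ω =>
    S.evalApprox_mul_nonneg ha hg _ _ _
  have hG := (S.measurable_stepEval (B := fun _ _ _ x y => x * y) (χ₀ := a) hB hgm hr k
    t).ennreal_ofReal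
  have e : S.lmean a g (n + 1) k t = ∫⁻ ω, ENNReal.ofReal (S.stepEval (fun _ _ _ x y => x * y) a g
      (S.approxAt (fun _ _ _ x y => x * y) a g n) k t (S.firstStep k ω)) ∂S.noiseLaw := by
    refine lintegral_congr_ae ?_
    filter_upwards [S.approxAt_succ_ae (fun _ _ _ x y => x * y) a g n k t] with ω hω
    rw [hω]
  rw [e, S.lintegral_firstStep k hG, mildLIntegral]
  refine lintegral_congr fun s => ?_
  split_ifs with hs
  · simp only [S.stepEval_of_le (x := (s, _)) hs]
    simp
  · simp only [S.stepEval_of_not_le (x := (s, _)) hs]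
    rw [lintegral_eventLaw]
    simp only [smul_eq_mul, ENNReal.ofReal_mul S.Cf_nonneg, ENNReal.ofReal_mul S.Cb_nonneg,
      ENNReal.ofReal_mul (h0 _ _ _), lintegral_const, measure_univ, mul_one, lbracket]
    have e1 : ∫⁻ w, ENNReal.ofReal S.Cf * ENNReal.ofReal
          (S.approxAt (fun _ _ _ x y => x * y) a g n k (t - s) w.1) ∂S.noiseLaw₃
        = ENNReal.ofReal S.Cf * S.lmean a g n k (t - s) := by
      rw [lintegral_const_mul' _ _ ENNReal.ofReal_ne_top]
      congr 1
      exact S.measurePreserving_noiseLaw₃_fst.lintegral_comp (hr' k (t - s))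
    have e2 : ∀ l m, ∫⁻ w, ENNReal.ofReal S.Cb * (ENNReal.ofReal
          (S.approxAt (fun _ _ _ x y => x * y) a g n l (t - s) w.2.1) * ENNReal.ofReal
          (S.approxAt (fun _ _ _ x y => x * y) a g n m (t - s) w.2.2)) ∂S.noiseLaw₃
        = ENNReal.ofReal S.Cb * (S.lmean a g n l (t - s) * S.lmean a g n m (t - s)) := by
      intro l m
      have hm : Measurable fun w : (Label → Mark d) × (Label → Mark d) => ENNReal.ofReal
          (S.approxAt (fun _ _ _ x y => x * y) a g n l (t - s) w.1) * ENNReal.ofReal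
          (S.approxAt (fun _ _ _ x y => x * y) a g n m (t - s) w.2) :=
        ((hr' l (t - s)).comp measurable_fst).mul ((hr' m (t - s)).comp measurable_snd)
      rw [lintegral_const_mul' _ _ ENNReal.ofReal_ne_top]
      congr 1
      refine (S.measurePreserving_noiseLaw₃_snd.lintegral_comp hm).trans ?_
      exact lintegral_prod_mul (hr' l (t - s)).aemeasurable (hr' m (t - s)).aemeasurable
    simp only [e1, e2]
    rw [add_assoc, add_comm]
    congr 1
    congr 1
    · ring
    · exact tsum_congr fun lm => by ring

section Mean

variable {E : Type*} [NormedAddCommGroup E] [NormedSpace ℝ E] [CompleteSpace E]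
  [MeasurableSpace E] [BorelSpace E] [SecondCountableTopology E]

/-- The expectation of the evaluation along the first `n` generations. -/
def mean (B : Mode d → Mode d → Mode d → E → E → E) (χ₀ : Mode d → E) (γ : Mode d → ℝ → E)
    (n : ℕ) (k : Mode d) (t : ℝ) : E :=
  ∫ ω, S.approxAt B χ₀ γ n k t ω ∂S.noiseLaw


omit [CompleteSpace E] in
lemma measurable_bilin (B : E →L[ℝ] E →L[ℝ] E) : Measurable fun x : E × E => B x.1 x.2 := by
  have : Continuous fun x : E × E => B x.1 x.2 := by fun_prop
  exact this.measurable

/-- This is the vector-valued analogue of `lmean_succ`. Integrability is what allows the expectation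
to pass inside the bilinear map; it is needed only at times in `[0, t]` because lifetimes are almost
surely nonnegative. -/
lemma mean_succ {B : Mode d → Mode d → Mode d → E →L[ℝ] E →L[ℝ] E} {χ₀ : Mode d → E}
    {γ : Mode d → ℝ → E} (hγ : ∀ k, Measurable (γ k)) {n : ℕ} {k : Mode d} {t : ℝ}
    (hn : ∀ k, ∀ u ∈ Icc 0 t,
      Integrable (S.approxAt (fun k l m x y => B k l m x y) χ₀ γ n k u) S.noiseLaw)
    (hn' : Integrable (S.approxAt (fun k l m x y => B k l m x y) χ₀ γ (n + 1) k t) S.noiseLaw) :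
    S.mean (fun k l m x y => B k l m x y) χ₀ γ (n + 1) k t
      = S.mildIntegral k (χ₀ k) (S.bracket (fun k l m x y => B k l m x y) γ
          (S.mean (fun k l m x y => B k l m x y) χ₀ γ n) k) t := by
  classical
  have hB : ∀ k l m : Mode d, Measurable fun x : E × E => B k l m x.1 x.2 := fun _ _ _ =>
    measurable_bilin _
  have hr := S.measurable_approxAt (B := fun k l m x y => B k l m x y) (χ₀ := χ₀) hB hγ n
  have hG := S.measurable_stepEval (B := fun k l m x y => B k l m x y) (χ₀ := χ₀) hB hγ hr k t
  have hae := S.approxAt_succ_ae (fun k l m x y => B k l m x y) χ₀ γ n k t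
  rw [mean, integral_congr_ae hae,
    S.integral_firstStep k hG.stronglyMeasurable (hn'.congr hae), mildIntegral]
  refine integral_congr_ae ?_
  filter_upwards [S.ae_lifeLaw_nonneg k] with s hs0
  split_ifs with hs
  · simp only [S.stepEval_of_le (x := (s, _)) hs]
    -- The root outlives `t`, so the event is irrelevant: its probabilities add up to one in front
    -- of the constant initial value.
    rw [tsum_congr fun lm : Mode d × Mode d => by rw [integral_const],
      (S.q_summable k).tsum_smul_const]
    simp only [integral_const, probReal_univ, one_smul]
    rw [← add_smul, ← add_smul]
    have := S.sum_eq_one k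
    rw [show S.death k + S.p k + ∑' lm : Mode d × Mode d, S.q k lm.1 lm.2 = 1 by linarith, one_smul]
  · simp only [S.stepEval_of_not_le (x := (s, _)) hs]
    have hu : t - s ∈ Icc 0 t := ⟨by linarith, by linarith⟩
    have e1 : ∫ w, S.Cf • S.approxAt (fun k l m x y => B k l m x y) χ₀ γ n k (t - s) w.1
          ∂S.noiseLaw₃
        = S.Cf • S.mean (fun k l m x y => B k l m x y) χ₀ γ n k (t - s) := by
      rw [integral_smul]
      congr 1
      unfold noiseLaw₃
      rw [integral_fun_fst (fun ω => S.approxAt (fun k l m x y => B k l m x y) χ₀ γ n k (t - s) ω)]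
      simp [mean]
    have e2 : ∀ l m, ∫ w, S.Cb • B k l m
          (S.approxAt (fun k l m x y => B k l m x y) χ₀ γ n l (t - s) w.2.1)
          (S.approxAt (fun k l m x y => B k l m x y) χ₀ γ n m (t - s) w.2.2) ∂S.noiseLaw₃
        = S.Cb • B k l m (S.mean (fun k l m x y => B k l m x y) χ₀ γ n l (t - s))
          (S.mean (fun k l m x y => B k l m x y) χ₀ γ n m (t - s)) := by
      intro l m
      rw [integral_smul]
      congr 1
      unfold noiseLaw₃
      rw [integral_fun_snd (fun w : (Label → Mark d) × (Label → Mark d) => B k l m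
          (S.approxAt (fun k l m x y => B k l m x y) χ₀ γ n l (t - s) w.1)
          (S.approxAt (fun k l m x y => B k l m x y) χ₀ γ n m (t - s) w.2)),
        integral_prod_bilin _ (hn l _ hu) (hn m _ hu)]
      simp [mean]
    simp only [e1, e2, integral_const, probReal_univ, one_smul, bracket, smul_smul]
    rw [add_assoc, add_comm, mul_comm S.Cf]
    simp only [mul_comm S.Cb]

end Mean

/-! ### The tree ends after finitely many generations -/

/-- The same branching mechanism with `C_f = C_b = 1`. -/
def unitCoeffs : Coeffs d :=
  { S with Cf := 1, Cb := 1, Cf_nonneg := zero_le_one, Cb_nonneg := zero_le_one }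

lemma unitCoeffs_noiseLaw : S.unitCoeffs.noiseLaw = S.noiseLaw := rfl

lemma unitCoeffs_branchingTree (k : Mode d) (ω : Label → Mark d) :
    S.unitCoeffs.branchingTree k ω = S.branchingTree k ω := by
  have h1 : ∀ α, S.unitCoeffs.Survives k ω α ↔ S.Survives k ω α := by
    intro α
    induction α with
    | nil => exact Iff.rfl
    | cons i α ih =>
      rw [Survives, Survives, ih]
      rfl
  have h2 : ∀ α, S.unitCoeffs.tauD k ω α = S.tauD k ω α := by
    intro α
    induction α with
    | nil => rfl
    | cons i α ih =>
      rw [tauD, tauD, ih]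
      rfl
  have h3 : ∀ α, S.unitCoeffs.tauB k ω α = S.tauB k ω α := by
    rintro (_ | ⟨i, α⟩)
    · rfl
    · exact h2 α
  funext α
  by_cases hs : S.Survives k ω α
  · simp only [branchingTree, h2, h3, if_pos hs, if_pos ((h1 α).2 hs)]
  · simp only [branchingTree, h2, h3, if_neg hs, if_neg (mt (h1 α).1 hs)]

/-- The indicator that the evaluation at time `t` only uses the first `n` generations. -/
def finished (n : ℕ) (t : ℝ) (𝒯 : Tree d) : ℝ :=
  S.unitCoeffs.evalApprox (fun _ _ _ x y => x * y) (fun _ => 1) (fun _ _ => 1) n t 𝒯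

lemma finished_le_one (n : ℕ) (t : ℝ) (𝒯 : Tree d) : S.finished n t 𝒯 ≤ 1 := by
  have h0 := S.unitCoeffs.evalApprox_mul_nonneg (a := fun _ => 1) (g := fun _ _ => 1)
    (fun _ => zero_le_one) (fun _ _ => zero_le_one)
  unfold finished
  induction n generalizing t 𝒯 with
  | zero => simp [evalApprox]
  | succ n ih =>
    unfold evalApprox
    split
    · exact zero_le_one
    split_ifs
    · exact le_rfl
    split
    · exact le_rfl
    · exact (one_mul _).trans_le (ih _ _)
    · exact (one_mul _).trans_le (mul_le_one₀ (ih _ _) (h0 _ _ _) (ih _ _))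
    · exact zero_le_one

/-- A nonzero value with all data equal to one means that no branch met the cutoff: a product is
nonzero only if both factors are, so the property passes to each subtree that is used. -/
lemma evalApprox_eq_of_finished {E : Type*} [NormedAddCommGroup E] [NormedSpace ℝ E]
    (B : Mode d → Mode d → Mode d → E → E → E) (χ₀ : Mode d → E) (γ : Mode d → ℝ → E)
    {n m : ℕ} {t : ℝ} {𝒯 : Tree d} (h : S.finished n t 𝒯 ≠ 0) (hm : n ≤ m) :
    S.evalApprox B χ₀ γ m t 𝒯 = S.evalApprox B χ₀ γ n t 𝒯 := by
  unfold finished at h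
  induction n generalizing m t 𝒯 with
  | zero => exact absurd rfl h
  | succ n ih =>
    obtain ⟨m, rfl⟩ := Nat.exists_eq_add_of_le' hm
    have hm' : n ≤ m + n := by omega
    rw [show m + (n + 1) = (m + n) + 1 by omega]
    rw [evalApprox] at h
    rw [evalApprox, evalApprox]
    split at h
    · rfl
    split_ifs at h ⊢ with ht
    · rfl
    split at h
    · rfl
    · rw [ih (right_ne_zero_of_smul h) hm']
    · have := right_ne_zero_of_smul h
      rw [ih (left_ne_zero_of_mul this) hm', ih (right_ne_zero_of_mul this) hm']
    · exact absurd rfl h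

/-- Tilting the exponential density of rate λ by e^{-θs} gives λ/(λ+θ) times the exponential density
of rate λ + θ. -/
lemma lintegral_exp_lifeLaw (k : Mode d) {θ : ℝ} (hθ : 0 ≤ θ) :
    ∫⁻ s, ENNReal.ofReal (Real.exp (-(θ * s))) ∂S.lifeLaw k
      = ENNReal.ofReal (S.rate k / (S.rate k + θ)) := by
  have hr := S.rate_pos k
  have hrθ : 0 < S.rate k + θ := by linarith
  have e : ∀ s, exponentialPDF (S.rate k) s * ENNReal.ofReal (Real.exp (-(θ * s)))
      = ENNReal.ofReal (S.rate k / (S.rate k + θ)) * exponentialPDF (S.rate k + θ) s := by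
    intro s
    rw [exponentialPDF_eq, exponentialPDF_eq]
    split_ifs
    · rw [← ENNReal.ofReal_mul (by positivity), ← ENNReal.ofReal_mul (by positivity)]
      congr 1
      rw [mul_assoc, ← Real.exp_add, ← mul_assoc, div_mul_cancel₀ _ hrθ.ne']
      congr 2
      ring
    · simp
  have hm : Measurable (exponentialPDF (S.rate k)) :=
    (measurable_exponentialPDFReal _).ennreal_ofReal
  have hm' : Measurable (exponentialPDF (S.rate k + θ)) :=
    (measurable_exponentialPDFReal _).ennreal_ofReal
  calc _ = ∫⁻ s, ENNReal.ofReal (Real.exp (-(θ * s))) ∂volume.withDensity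
        (exponentialPDF (S.rate k)) := rfl
    _ = ∫⁻ s, exponentialPDF (S.rate k) s * ENNReal.ofReal (Real.exp (-(θ * s))) :=
      lintegral_withDensity_eq_lintegral_mul _ hm (by fun_prop)
    _ = _ := by
      simp_rw [e]
      rw [lintegral_const_mul _ hm', lintegral_exponentialPDF_eq_one hrθ, mul_one]

/-- Here p + 2q is the mean number of children and λ/(λ+θ) the discount over one lifetime. Outside a
finite set of modes p + 2q is below 3/8. On that set p + 2q ≤ 2, and θ at least three times each
rate makes the discount at most 1/4. The rates need not be bounded over all modes. -/
lemma exists_exponent : ∃ θ : ℝ, 0 ≤ θ ∧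
    ∀ k, (S.p k + 2 * S.qTot k) * (S.rate k / (S.rate k + θ)) ≤ 1 / 2 := by
  have h : ∀ᶠ k in cofinite, S.p k < 1 / 8 ∧ S.qTot k < 1 / 8 :=
    (S.p_tendsto.eventually_lt_const (by norm_num)).and
      (S.q_tendsto.eventually_lt_const (by norm_num))
  have hf : {k | ¬ (S.p k < 1 / 8 ∧ S.qTot k < 1 / 8)}.Finite := h
  refine ⟨3 * ∑ k ∈ hf.toFinset, S.rate k,
    mul_nonneg (by norm_num) (Finset.sum_nonneg fun k _ => (S.rate_pos k).le), fun k => ?_⟩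
  set θ := 3 * ∑ k ∈ hf.toFinset, S.rate k with hθd
  have hθ : 0 ≤ θ := mul_nonneg (by norm_num) (Finset.sum_nonneg fun k _ => (S.rate_pos k).le)
  have hr := S.rate_pos k
  have hq := S.qTot_nonneg k
  have hp := (S.p_mem k).1
  have h1 := S.sum_eq_one' k
  have hd := (S.death_mem k).1
  rw [← mul_div_assoc, div_le_iff₀ (by linarith)]
  by_cases hk : S.p k < 1 / 8 ∧ S.qTot k < 1 / 8
  · nlinarith [hk.1, hk.2]
  · have : S.rate k ≤ ∑ k ∈ hf.toFinset, S.rate k :=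
      Finset.single_le_sum (f := S.rate) (fun k _ => (S.rate_pos k).le) (hf.mem_toFinset.2 hk)
    have h3 : 3 * S.rate k ≤ θ := by linarith
    nlinarith

/-- A union bound over the children: if each subtree is unfinished with probability at most `e`, the
tree is unfinished with probability at most (p + 2q)`e`. Complementary probabilities are kept on the
other side to avoid truncated subtraction. -/
lemma one_le_lbracket_add {m : Mode d → ℝ → ℝ≥0∞} {u : ℝ} {e : ℝ≥0∞} (hm : ∀ k, m k u ≤ 1)
    (he : ∀ k, 1 ≤ m k u + e) (k : Mode d) :
    1 ≤ S.unitCoeffs.lbracket (fun _ _ => 1) m k u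
      + (ENNReal.ofReal (S.p k) + 2 * ENNReal.ofReal (S.qTot k)) * e := by
  have h1 : (1 : ℝ≥0∞)
      = ENNReal.ofReal (S.p k) + ENNReal.ofReal (S.qTot k) + ENNReal.ofReal (S.death k) := by
    rw [← ENNReal.ofReal_add (S.p_mem k).1 (S.qTot_nonneg k),
      ← ENNReal.ofReal_add (add_nonneg (S.p_mem k).1 (S.qTot_nonneg k)) (S.death_mem k).1,
      S.sum_eq_one' k, ENNReal.ofReal_one]
  have h2 : ENNReal.ofReal (S.p k) ≤
      ENNReal.ofReal (S.p k) * m k u + ENNReal.ofReal (S.p k) * e := by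
    rw [← mul_add]
    exact le_mul_of_one_le_right' (he k)
  have hmul : ∀ l n, 1 ≤ m l u * m n u + 2 * e := fun l n => calc
    1 ≤ m l u + e := he l
    _ ≤ m l u * (m n u + e) + e := by
      gcongr
      exact le_mul_of_one_le_right' (he n)
    _ = m l u * m n u + (m l u * e + e) := by ring
    _ ≤ m l u * m n u + (1 * e + e) := by gcongr; exact hm l
    _ = m l u * m n u + 2 * e := by ring
  have h3 : ENNReal.ofReal (S.qTot k)
      ≤ ∑' lm : Mode d × Mode d, ENNReal.ofReal (S.q k lm.1 lm.2) * (m lm.1 u * m lm.2 u)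
        + 2 * ENNReal.ofReal (S.qTot k) * e := by
    rw [ofReal_qTot, mul_comm (2 : ℝ≥0∞), mul_assoc, ← ENNReal.tsum_mul_right, ← ENNReal.tsum_add]
    refine ENNReal.tsum_le_tsum fun lm => ?_
    rw [← mul_add]
    exact le_mul_of_one_le_right' (hmul _ _)
  have e1 : S.unitCoeffs.Cf = 1 := rfl
  have e2 : S.unitCoeffs.Cb = 1 := rfl
  calc (1 : ℝ≥0∞) = _ := h1
    _ ≤ (ENNReal.ofReal (S.p k) * m k u + ENNReal.ofReal (S.p k) * e)
        + (∑' lm : Mode d × Mode d, ENNReal.ofReal (S.q k lm.1 lm.2) * (m lm.1 u * m lm.2 u)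
        + 2 * ENNReal.ofReal (S.qTot k) * e) + ENNReal.ofReal (S.death k) := by gcongr
    _ = _ := by
      simp only [lbracket, e1, e2, one_mul, mul_one]
      change _ = ENNReal.ofReal (S.p k) * m k u + ∑' lm : Mode d × Mode d,
        ENNReal.ofReal (S.q k lm.1 lm.2) * (m lm.1 u * m lm.2 u) + ENNReal.ofReal (S.death k) + _
      ring

/-- The probability that the evaluation only uses the first `n` generations. -/
def finishedMean (n : ℕ) (k : Mode d) (t : ℝ) : ℝ≥0∞ :=
  S.unitCoeffs.lmean (fun _ => 1) (fun _ _ => 1) n k t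

lemma finishedMean_le_one (n : ℕ) (k : Mode d) (t : ℝ) : S.finishedMean n k t ≤ 1 := by
  calc S.finishedMean n k t ≤ ∫⁻ _, 1 ∂S.noiseLaw :=
        lintegral_mono fun ω => ENNReal.ofReal_le_one.2 (S.finished_le_one n t _)
    _ = 1 := by simp

/-- Conditioning on the lifetime `s` of the root replaces the weight e^{θt} by e^{θ(t-s)};
integrating over `s` produces exactly the factor that is at most 1/2 by the choice of θ. -/
lemma one_le_finishedMean_add {θ : ℝ} (hθ : 0 ≤ θ)
    (h : ∀ k, (S.p k + 2 * S.qTot k) * (S.rate k / (S.rate k + θ)) ≤ 1 / 2) (n : ℕ) (k : Mode d)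
    {t : ℝ} (ht : 0 ≤ t) :
    1 ≤ S.finishedMean n k t + ENNReal.ofReal (Real.exp (θ * t) * (1 / 2) ^ n) := by
  classical
  induction n generalizing k t with
  | zero =>
    refine le_add_left ?_
    rw [← ENNReal.ofReal_one]
    exact ENNReal.ofReal_le_ofReal (by simpa using mul_nonneg hθ ht)
  | succ n ih =>
    set c : ℝ := (S.p k + 2 * S.qTot k) * (Real.exp (θ * t) * (1 / 2) ^ n) with hc
    have hpq : 0 ≤ S.p k + 2 * S.qTot k := by linarith [(S.p_mem k).1, S.qTot_nonneg k]
    have hc0 : 0 ≤ c := by positivity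
    have e : S.finishedMean (n + 1) k t = S.mildLIntegral k 1
        (S.unitCoeffs.lbracket (fun _ _ => 1) (S.finishedMean n) k) t := by
      have := S.unitCoeffs.lmean_succ (a := fun _ => 1) (g := fun _ _ => 1)
        (fun _ => zero_le_one) (fun _ _ => zero_le_one) (fun _ => measurable_const) n k t
      simp only [ENNReal.ofReal_one] at this
      exact this
    rw [e]
    have hm : Measurable fun s : ℝ => ENNReal.ofReal c * ENNReal.ofReal (Real.exp (-(θ * s))) := by
      fun_prop
    calc (1 : ℝ≥0∞) = ∫⁻ _, 1 ∂S.lifeLaw k := by simp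
      _ ≤ ∫⁻ s, (if t ≤ s then 1 else
            S.unitCoeffs.lbracket (fun _ _ => 1) (S.finishedMean n) k (t - s))
            + ENNReal.ofReal c * ENNReal.ofReal (Real.exp (-(θ * s))) ∂S.lifeLaw k := by
        refine lintegral_mono_ae ?_
        filter_upwards [S.ae_lifeLaw_nonneg k] with s hs
        split_ifs with hts
        · exact le_self_add
        · refine (S.one_le_lbracket_add (fun k => S.finishedMean_le_one n k _)
            (fun k => ih k (by linarith : 0 ≤ t - s)) k).trans_eq ?_
          congr 1
          rw [show (2 : ℝ≥0∞) = ENNReal.ofReal 2 by simp, ← ENNReal.ofReal_mul zero_le_two,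
            ← ENNReal.ofReal_add (S.p_mem k).1 (by linarith [S.qTot_nonneg k]),
            ← ENNReal.ofReal_mul hpq, ← ENNReal.ofReal_mul hc0]
          congr 1
          rw [hc, mul_sub, sub_eq_add_neg, Real.exp_add]
          ring
      _ = S.mildLIntegral k 1 (S.unitCoeffs.lbracket (fun _ _ => 1) (S.finishedMean n) k) t
            + ENNReal.ofReal c * ENNReal.ofReal (S.rate k / (S.rate k + θ)) := by
        rw [lintegral_add_right _ hm, lintegral_const_mul _ (by fun_prop),
          lintegral_exp_lifeLaw S k hθ]
        rfl
      _ ≤ _ := by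
        gcongr
        rw [← ENNReal.ofReal_mul hc0]
        refine ENNReal.ofReal_le_ofReal ?_
        have := mul_le_mul_of_nonneg_right (h k)
          (by positivity : 0 ≤ Real.exp (θ * t) * (1 / 2) ^ n)
        calc c * (S.rate k / (S.rate k + θ)) = (S.p k + 2 * S.qTot k) *
              (S.rate k / (S.rate k + θ)) * (Real.exp (θ * t) * (1 / 2) ^ n) := by rw [hc]; ring
          _ ≤ _ := this
          _ = _ := by ring

lemma measurable_finished (n : ℕ) (t : ℝ) : Measurable (S.finished n t) :=
  (S.unitCoeffs.measurable_evalApprox (B := fun _ _ _ x y => x * y) (χ₀ := fun _ => (1 : ℝ))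
    (γ := fun _ _ => 1) (fun _ _ _ => by fun_prop) (fun _ => measurable_const) n).comp
    measurable_prodMk_left

lemma ae_exists_finished (k : Mode d) {t : ℝ} (ht : 0 ≤ t) :
    ∀ᵐ 𝒯 ∂S.treeLaw k, ∃ n, S.finished n t 𝒯 ≠ 0 := by
  obtain ⟨θ, hθ, h⟩ := S.exists_exponent
  set Z : Set (Tree d) := {𝒯 | ∀ n, S.finished n t 𝒯 = 0} with hZ
  have hZm : MeasurableSet Z := by
    rw [hZ, ofPred_forall]
    exact MeasurableSet.iInter fun n => S.measurable_finished n t (measurableSet_singleton 0)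
  have hle : ∀ n, S.treeLaw k Z ≤ ENNReal.ofReal (Real.exp (θ * t) * (1 / 2) ^ n) := by
    intro n
    have e : S.finishedMean n k t = ∫⁻ 𝒯, ENNReal.ofReal (S.finished n t 𝒯) ∂S.treeLaw k := by
      rw [treeLaw, lintegral_map (S.measurable_finished n t).ennreal_ofReal
        (S.measurable_branchingTree k), finishedMean, lmean, unitCoeffs_noiseLaw]
      simp only [approxAt, unitCoeffs_branchingTree]
      rfl
    -- Never finishing and having finished within `n` generations are disjoint, so the lower bound
    -- for the second probability bounds the first.
    have h1 : S.treeLaw k Z + S.finishedMean n k t ≤ 1 := calc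
      _ = ∫⁻ 𝒯, Z.indicator 1 𝒯 + ENNReal.ofReal (S.finished n t 𝒯) ∂S.treeLaw k := by
        rw [lintegral_add_left (measurable_one.indicator hZm), lintegral_indicator_one hZm, e]
      _ ≤ ∫⁻ _, 1 ∂S.treeLaw k := by
        refine lintegral_mono fun 𝒯 => ?_
        by_cases hT : 𝒯 ∈ Z
        · simp [hT, hT n]
        · simpa [hT] using S.finished_le_one n t 𝒯
      _ = 1 := by simp
    have h2 := h1.trans (S.one_le_finishedMean_add hθ h n k ht)
    rw [add_comm] at h2
    exact (ENNReal.add_le_add_iff_left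
      ((S.finishedMean_le_one n k t).trans_lt ENNReal.one_lt_top).ne).1 h2
  have hlim : Tendsto (fun n : ℕ => ENNReal.ofReal (Real.exp (θ * t) * (1 / 2) ^ n)) atTop
      (𝓝 0) := by
    rw [← ENNReal.ofReal_zero]
    refine ENNReal.tendsto_ofReal ?_
    simpa using (tendsto_pow_atTop_nhds_zero_of_lt_one (r := (1 / 2 : ℝ)) (by norm_num)
      (by norm_num)).const_mul (Real.exp (θ * t))
  have h0 : S.treeLaw k Z = 0 := le_antisymm (ge_of_tendsto' hlim hle) zero_le
  rw [ae_iff]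
  convert h0 using 2
  ext 𝒯
  simp [hZ]

/-! ### Passage to infinitely many generations -/

section Limit

variable {E : Type*} [NormedAddCommGroup E] [NormedSpace ℝ E]

lemma ae_evalApprox_eq_eval (B : Mode d → Mode d → Mode d → E → E → E) (χ₀ : Mode d → E)
    (γ : Mode d → ℝ → E) (k : Mode d) {t : ℝ} (ht : 0 ≤ t) :
    ∀ᵐ 𝒯 ∂S.treeLaw k, ∃ n, ∀ m, n ≤ m →
      S.evalApprox B χ₀ γ m t 𝒯 = S.eval B χ₀ γ t 𝒯 := by
  filter_upwards [S.ae_exists_finished k ht] with 𝒯 ⟨n, hn⟩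
  have h : ∃ n, ∀ m, n ≤ m → S.evalApprox B χ₀ γ m t 𝒯 = S.evalApprox B χ₀ γ n t 𝒯 :=
    ⟨n, fun m hm => S.evalApprox_eq_of_finished B χ₀ γ hn hm⟩
  refine ⟨h.choose, fun m hm => ?_⟩
  rw [eval, dif_pos h]
  exact h.choose_spec m hm

lemma ae_tendsto_evalApprox (B : Mode d → Mode d → Mode d → E → E → E) (χ₀ : Mode d → E)
    (γ : Mode d → ℝ → E) (k : Mode d) {t : ℝ} (ht : 0 ≤ t) :
    ∀ᵐ 𝒯 ∂S.treeLaw k, Tendsto (fun n => S.evalApprox B χ₀ γ n t 𝒯) atTop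
      (𝓝 (S.eval B χ₀ γ t 𝒯)) := by
  filter_upwards [S.ae_evalApprox_eq_eval B χ₀ γ k ht] with 𝒯 ⟨n, hn⟩
  exact tendsto_atTop_of_eventually_const hn

omit [NormedSpace ℝ E] in
lemma evalApprox_le_evalComparison (χ₀ : Mode d → E) (γ : Mode d → ℝ → E) (k : Mode d) {t : ℝ}
    (ht : 0 ≤ t) : ∀ᵐ 𝒯 ∂S.treeLaw k, ∀ n,
      S.evalApprox (fun _ _ _ x y => x * y) (fun k => ‖χ₀ k‖) (fun k s => ‖γ k s‖) n t 𝒯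
        ≤ S.evalComparison χ₀ γ t 𝒯 := by
  filter_upwards [S.ae_tendsto_evalApprox (fun _ _ _ x y : _ => x * y) (fun k => ‖χ₀ k‖)
    (fun k s => ‖γ k s‖) k ht] with 𝒯 h n
  refine Monotone.ge_of_tendsto (monotone_nat_of_le_succ fun n => ?_) h n
  exact S.evalApprox_mul_le_succ (fun _ => norm_nonneg _) (fun _ _ => norm_nonneg _) _ _ _

variable [MeasurableSpace E] [BorelSpace E]

/-- The expectation of the comparison evaluation along the first `n` generations, for the data
`|χ₀|`, `|γ|`. -/
abbrev normMean (χ₀ : Mode d → E) (γ : Mode d → ℝ → E) : ℕ → Mode d → ℝ → ℝ≥0∞ :=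
  S.lmean (fun k => ‖χ₀ k‖) (fun k s => ‖γ k s‖)

omit [NormedSpace ℝ E] [MeasurableSpace E] [BorelSpace E] in
lemma normMean_mono (χ₀ : Mode d → E) (γ : Mode d → ℝ → E) (k : Mode d) (t : ℝ) :
    Monotone fun n => S.normMean χ₀ γ n k t :=
  monotone_nat_of_le_succ fun _ => lintegral_mono fun _ => ENNReal.ofReal_le_ofReal
    (S.evalApprox_mul_le_succ (fun _ => norm_nonneg _) (fun _ _ => norm_nonneg _) _ _ _)

variable {χ₀ : Mode d → E} {γ : Mode d → ℝ → E} (hγ : ∀ k, Measurable (γ k))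
include hγ

omit [NormedSpace ℝ E] in
-- Monotone convergence over trees: almost surely the increasing stopped evaluations become equal to
-- the full one.
lemma iSup_normMean (k : Mode d) {t : ℝ} (ht : 0 ≤ t) :
    ⨆ n, S.normMean χ₀ γ n k t = S.comparisonExpectation χ₀ γ k t := by
  have hm : ∀ n, Measurable fun 𝒯 => ENNReal.ofReal (S.evalApprox (fun _ _ _ x y => x * y)
      (fun k => ‖χ₀ k‖) (fun k s => ‖γ k s‖) n t 𝒯) := fun n =>
    ((S.measurable_evalApprox (B := fun _ _ _ x y => x * y) (fun _ _ _ => by fun_prop)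
      (fun k => (hγ k).norm) n).comp measurable_prodMk_left).ennreal_ofReal
  have e : ∀ n, S.normMean χ₀ γ n k t = ∫⁻ 𝒯, ENNReal.ofReal (S.evalApprox
      (fun _ _ _ x y => x * y) (fun k => ‖χ₀ k‖) (fun k s => ‖γ k s‖) n t 𝒯) ∂S.treeLaw k :=
    fun n => (lintegral_map (hm n) (S.measurable_branchingTree k)).symm
  simp_rw [e]
  rw [← lintegral_iSup hm (monotone_nat_of_le_succ fun n 𝒯 => ENNReal.ofReal_le_ofReal
    (S.evalApprox_mul_le_succ (fun _ => norm_nonneg _) (fun _ _ => norm_nonneg _) _ _ _))]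
  refine lintegral_congr_ae ?_
  filter_upwards [S.ae_evalApprox_eq_eval (fun _ _ _ x y : _ => x * y) (fun k => ‖χ₀ k‖)
    (fun k s => ‖γ k s‖) k ht, S.evalApprox_le_evalComparison χ₀ γ k ht] with 𝒯 ⟨n, hn⟩ hle
  refine le_antisymm (iSup_le fun n => ENNReal.ofReal_le_ofReal (hle n)) ?_
  refine le_iSup_of_le n (ENNReal.ofReal_le_ofReal ?_)
  exact (hn n le_rfl).ge

omit [NormedSpace ℝ E] in
lemma normMean_le (n : ℕ) (k : Mode d) {t : ℝ} (ht : 0 ≤ t) :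
    S.normMean χ₀ γ n k t ≤ S.comparisonExpectation χ₀ γ k t := by
  rw [← S.iSup_normMean hγ k ht]
  exact le_iSup (fun n => S.normMean χ₀ γ n k t) n

variable [SecondCountableTopology E] {B : Mode d → Mode d → Mode d → E →L[ℝ] E →L[ℝ] E}
  (hB : ∀ k l m x y, ‖B k l m x y‖ ≤ ‖x‖ * ‖y‖)

lemma measurable_evalApprox_bilin (n : ℕ) (t : ℝ) :
    Measurable (S.evalApprox (fun k l m x y => B k l m x y) χ₀ γ n t) :=
  (S.measurable_evalApprox (B := fun k l m x y => B k l m x y) (fun _ _ _ => measurable_bilin _)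
    hγ n).comp measurable_prodMk_left

/-- The full evaluation is defined by a choice of generation; its measurability comes from being an
almost sure limit of the stopped evaluations. -/
lemma aestronglyMeasurable_eval (k : Mode d) {t : ℝ} (ht : 0 ≤ t) :
    AEStronglyMeasurable (S.eval (fun k l m x y => B k l m x y) χ₀ γ t) (S.treeLaw k) :=
  aestronglyMeasurable_of_tendsto_ae atTop
    (fun n => (S.measurable_evalApprox_bilin hγ n t).aestronglyMeasurable)
    (S.ae_tendsto_evalApprox _ χ₀ γ k ht)

include hB

omit [MeasurableSpace E] [BorelSpace E] hγ [SecondCountableTopology E] in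
lemma norm_eval_le (k : Mode d) {t : ℝ} (ht : 0 ≤ t) : ∀ᵐ 𝒯 ∂S.treeLaw k,
    ‖S.eval (fun k l m x y => B k l m x y) χ₀ γ t 𝒯‖ ≤ S.evalComparison χ₀ γ t 𝒯 := by
  filter_upwards [S.ae_tendsto_evalApprox (fun k l m x y => B k l m x y) χ₀ γ k ht,
    S.evalApprox_le_evalComparison χ₀ γ k ht] with 𝒯 h hle
  exact le_of_tendsto' h.norm fun n => (S.norm_evalApprox_le hB χ₀ γ n t 𝒯).trans (hle n)

omit [MeasurableSpace E] [BorelSpace E] hγ [SecondCountableTopology E] in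
lemma lintegral_enorm_eval_le (k : Mode d) {t : ℝ} (ht : 0 ≤ t) :
    ∫⁻ 𝒯, ‖S.eval (fun k l m x y => B k l m x y) χ₀ γ t 𝒯‖ₑ ∂S.treeLaw k
      ≤ S.comparisonExpectation χ₀ γ k t := by
  refine lintegral_mono_ae ?_
  filter_upwards [S.norm_eval_le hB k ht] with 𝒯 h
  rw [← ofReal_norm]
  exact ENNReal.ofReal_le_ofReal h

lemma integrable_eval (k : Mode d) {t : ℝ} (ht : 0 ≤ t)
    (hfin : S.comparisonExpectation χ₀ γ k t < ⊤) :
    Integrable (S.eval (fun k l m x y => B k l m x y) χ₀ γ t) (S.treeLaw k) :=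
  ⟨S.aestronglyMeasurable_eval hγ k ht, (S.lintegral_enorm_eval_le hB k ht).trans_lt hfin⟩

lemma integrable_approxAt (n : ℕ) (k : Mode d) {t : ℝ} (ht : 0 ≤ t)
    (hfin : S.comparisonExpectation χ₀ γ k t < ⊤) :
    Integrable (S.approxAt (fun k l m x y => B k l m x y) χ₀ γ n k t) S.noiseLaw := by
  refine ⟨((S.measurable_approxAt (B := fun k l m x y => B k l m x y)
    (fun _ _ _ => measurable_bilin _) hγ n k).comp measurable_prodMk_left).aestronglyMeasurable,
    lt_of_le_of_lt ?_ ((S.normMean_le hγ n k ht).trans_lt hfin)⟩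
  refine lintegral_mono fun ω => ?_
  rw [← ofReal_norm]
  exact ENNReal.ofReal_le_ofReal (S.norm_evalApprox_le hB χ₀ γ n t _)

omit [MeasurableSpace E] [BorelSpace E] hγ [SecondCountableTopology E] in
lemma enorm_mean_le (n : ℕ) (k : Mode d) (t : ℝ) :
    ‖S.mean (fun k l m x y => B k l m x y) χ₀ γ n k t‖ₑ ≤ S.normMean χ₀ γ n k t := by
  refine (enorm_integral_le_lintegral_enorm _).trans (lintegral_mono fun ω => ?_)
  rw [← ofReal_norm]
  exact ENNReal.ofReal_le_ofReal (S.norm_evalApprox_le hB χ₀ γ n t _)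

lemma tendsto_mean (k : Mode d) {t : ℝ} (ht : 0 ≤ t)
    (hfin : S.comparisonExpectation χ₀ γ k t < ⊤) :
    Tendsto (fun n => S.mean (fun k l m x y => B k l m x y) χ₀ γ n k t) atTop
      (𝓝 (S.expectation (fun k l m x y => B k l m x y) χ₀ γ k t)) := by
  have e : ∀ n, S.mean (fun k l m x y => B k l m x y) χ₀ γ n k t
      = ∫ 𝒯, S.evalApprox (fun k l m x y => B k l m x y) χ₀ γ n t 𝒯 ∂S.treeLaw k := fun n =>
    (integral_map (S.measurable_branchingTree k).aemeasurable
      (S.measurable_evalApprox_bilin hγ n t).aestronglyMeasurable).symm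
  simp_rw [e]
  -- The comparison evaluation is itself an evaluation, over the reals with multiplication as the
  -- bilinear map.
  have hm : AEStronglyMeasurable (S.evalComparison χ₀ γ t) (S.treeLaw k) :=
    S.aestronglyMeasurable_eval (E := ℝ) (B := fun _ _ _ => ContinuousLinearMap.mul ℝ ℝ)
      (fun k => (hγ k).norm) k ht
  have hi : Integrable (S.evalComparison χ₀ γ t) (S.treeLaw k) := by
    refine ⟨hm, ?_⟩
    rw [HasFiniteIntegral]
    refine (lintegral_congr_ae ?_).trans_lt hfin
    -- Dominating a norm already makes the comparison evaluation nonnegative, so its norm can be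
    -- dropped.
    filter_upwards [S.norm_eval_le hB k ht] with 𝒯 h
    rw [← ofReal_norm, Real.norm_of_nonneg ((norm_nonneg _).trans h)]
  refine tendsto_integral_of_dominated_convergence (S.evalComparison χ₀ γ t)
    (fun n => (S.measurable_evalApprox_bilin hγ n t).aestronglyMeasurable) hi (fun n => ?_)
    (S.ae_tendsto_evalApprox _ χ₀ γ k ht)
  filter_upwards [S.evalApprox_le_evalComparison χ₀ γ k ht] with 𝒯 hle
  exact (S.norm_evalApprox_le hB χ₀ γ n t 𝒯).trans (hle n)

end Limit

/-! ### The law of the time that remains at the death of the root -/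

/-- The law of the time `t - s` that remains at the death time `s` of a particle at `k`, on the
event that it dies before `t`. -/
def remainingLaw (k : Mode d) (t : ℝ) : Measure ℝ :=
  (volume.restrict (Ioc 0 t)).withDensity
    fun u => ENNReal.ofReal (S.rate k * Real.exp (-(S.rate k * (t - u))))

lemma lifeLaw_eq (k : Mode d) :
    S.lifeLaw k = volume.withDensity (exponentialPDF (S.rate k)) := rfl

lemma lifeLaw_Ici (k : Mode d) {t : ℝ} (ht : 0 ≤ t) :
    S.lifeLaw k (Ici t) = ENNReal.ofReal (Real.exp (-(S.rate k * t))) := by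
  have h : S.lifeLaw k (Iio t) = ENNReal.ofReal (1 - Real.exp (-(S.rate k * t))) := by
    rw [lifeLaw_eq, withDensity_apply _ measurableSet_Iio, setLIntegral_congr Iio_ae_eq_Iic,
      lintegral_exponentialPDF_eq_antiDeriv (S.rate_pos k), if_pos ht]
  rw [← compl_Iio, prob_compl_eq_one_sub measurableSet_Iio, h, ← ENNReal.ofReal_one,
    ← ENNReal.ofReal_sub]
  · simp
  · exact sub_nonneg.2 (Real.exp_le_one_iff.2 (by nlinarith [S.rate_pos k]))

/-- The substitution u = t - s carries `0 ≤ s < t` to `0 < u ≤ t`, which explains the half-open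
interval in `remainingLaw`. -/
lemma map_subLeft_lifeLaw (k : Mode d) (t : ℝ) :
    ((S.lifeLaw k).restrict (Iio t)).map (MeasurableEquiv.subLeft t) = S.remainingLaw k t := by
  refine Measure.ext fun A hA => ?_
  have hA' : MeasurableSet ((fun s => t - s) ⁻¹' A) := (measurable_const.sub measurable_id) hA
  have hpre : MeasurableEquiv.subLeft t ⁻¹' A = (fun s => t - s) ⁻¹' A := rfl
  rw [MeasurableEquiv.map_apply, hpre, Measure.restrict_apply hA',
    remainingLaw, withDensity_apply _ hA, Measure.restrict_restrict hA, lifeLaw_eq,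
    withDensity_apply _ (hA'.inter measurableSet_Iio),
    ← lintegral_indicator (hA'.inter measurableSet_Iio),
    ← lintegral_indicator (hA.inter measurableSet_Ioc),
    ← lintegral_sub_left_eq_self _ t]
  refine lintegral_congr fun s => ?_
  simp only [indicator, exponentialPDF_eq, mem_inter_iff, mem_preimage, mem_Iio, mem_Ioc,
    sub_sub_cancel]
  by_cases h1 : s ∈ A <;> by_cases h2 : 0 < s <;> by_cases h3 : s ≤ t <;> simp [h1, h2, h3]

/-- Splitting at the event that the root lives until `t` turns the average over lifetimes into the
mild formula: that event has probability e^{-λt}. -/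
lemma mildLIntegral_eq (k : Mode d) (c : ℝ≥0∞) (F : ℝ → ℝ≥0∞) {t : ℝ} (ht : 0 ≤ t) :
    S.mildLIntegral k c F t = ENNReal.ofReal (Real.exp (-(S.rate k * t))) * c
      + ∫⁻ u, F u ∂S.remainingLaw k t := by
  classical
  have h1 : EqOn (fun s => if t ≤ s then c else F (t - s)) (fun _ => c) (Ici t) :=
    fun s hs => if_pos hs
  have h2 : EqOn (fun s => if t ≤ s then c else F (t - s)) (fun s => F (t - s)) (Iio t) :=
    fun s hs => if_neg (not_le.2 hs)
  rw [mildLIntegral, ← lintegral_add_compl _ (measurableSet_Ici (a := t)), compl_Ici,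
    setLIntegral_congr_fun measurableSet_Ici h1, setLIntegral_congr_fun measurableSet_Iio h2,
    setLIntegral_const, lifeLaw_Ici S k ht, mul_comm, ← map_subLeft_lifeLaw, lintegral_map_equiv]
  rfl

section Bochner

variable {E : Type*} [NormedAddCommGroup E] [NormedSpace ℝ E]

lemma mildIntegral_eq [CompleteSpace E] (k : Mode d) (c : E) {F : ℝ → E} {t : ℝ} (ht : 0 ≤ t)
    (hF : Integrable F (S.remainingLaw k t)) :
    S.mildIntegral k c F t = Real.exp (-(S.rate k * t)) • c + ∫ u, F u ∂S.remainingLaw k t := by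
  classical
  have h1 : EqOn (fun s => if t ≤ s then c else F (t - s)) (fun _ => c) (Ici t) :=
    fun s hs => if_pos hs
  have h2 : EqOn (fun s => if t ≤ s then c else F (t - s)) (fun s => F (t - s)) (Iio t) :=
    fun s hs => if_neg (not_le.2 hs)
  rw [← map_subLeft_lifeLaw] at hF
  have hF' : IntegrableOn (fun s => F (t - s)) (Iio t) (S.lifeLaw k) :=
    (MeasurableEquiv.subLeft t).measurableEmbedding.integrable_map_iff.1 hF
  have hi : Integrable (fun s => if t ≤ s then c else F (t - s)) (S.lifeLaw k) := by
    rw [← integrableOn_univ, ← Iio_union_Ici (a := t)]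
    exact (hF'.congr_fun h2.symm measurableSet_Iio).union
      ((integrableOn_const (measure_ne_top _ _)).congr_fun h1.symm measurableSet_Ici)
  rw [mildIntegral, ← integral_add_compl (measurableSet_Ici (a := t)) hi, compl_Ici,
    setIntegral_congr_fun measurableSet_Ici h1, setIntegral_congr_fun measurableSet_Iio h2,
    setIntegral_const, measureReal_def, lifeLaw_Ici S k ht,
    ENNReal.toReal_ofReal (Real.exp_pos _).le, ← map_subLeft_lifeLaw, integral_map_equiv]
  rfl

lemma integral_remainingLaw (k : Mode d) (F : ℝ → E) {t : ℝ} (ht : 0 ≤ t) :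
    ∫ u, F u ∂S.remainingLaw k t
      = ∫ s in (0 : ℝ)..t, (S.rate k * Real.exp (-(S.rate k * (t - s)))) • F s := by
  rw [remainingLaw, integral_withDensity_eq_integral_toReal_smul (by fun_prop)
    (Eventually.of_forall fun _ => ENNReal.ofReal_lt_top), intervalIntegral.integral_of_le ht]
  refine integral_congr_ae (Eventually.of_forall fun s => ?_)
  simp only
  rw [ENNReal.toReal_ofReal (mul_nonneg (S.rate_pos k).le (Real.exp_pos _).le)]

lemma remainingLaw_absolutelyContinuous (k : Mode d) {t T : ℝ} (ht : t ≤ T) :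
    S.remainingLaw k t ≪ volume.restrict (Icc 0 T) :=
  (withDensity_absolutelyContinuous _ _).trans
    (Measure.restrict_mono (Ioc_subset_Icc_self.trans (Icc_subset_Icc_right ht))
      le_rfl).absolutelyContinuous

/-- The density is strictly positive, so statements that hold almost surely for the remaining time
at `T` hold at Lebesgue-almost every time. -/
lemma absolutelyContinuous_remainingLaw (k : Mode d) (T : ℝ) :
    volume.restrict (Icc 0 T) ≪ S.remainingLaw k T := by
  rw [← restrict_Ioc_eq_restrict_Icc]
  refine withDensity_absolutelyContinuous' (by fun_prop) (Eventually.of_forall fun u => ?_)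
  exact (ENNReal.ofReal_pos.2 (mul_pos (S.rate_pos k) (Real.exp_pos _))).ne'

lemma ae_remainingLaw_mem (k : Mode d) (t : ℝ) : ∀ᵐ u ∂S.remainingLaw k t, u ∈ Ioc 0 t :=
  (withDensity_absolutelyContinuous _ _).ae_le (ae_restrict_mem measurableSet_Ioc)

omit [NormedSpace ℝ E] in
lemma integrable_remainingLaw (k : Mode d) {F : ℝ → E} {t T : ℝ} (ht : t ≤ T)
    (hF : IntegrableOn F (Icc 0 T)) : Integrable F (S.remainingLaw k t) := by
  have hle : S.remainingLaw k t ≤ ENNReal.ofReal (S.rate k) • volume.restrict (Icc 0 T) := calc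
    S.remainingLaw k t ≤ (volume.restrict (Ioc 0 t)).withDensity
        fun _ => ENNReal.ofReal (S.rate k) := by
      refine withDensity_mono ?_
      filter_upwards [ae_restrict_mem measurableSet_Ioc] with u hu
      refine ENNReal.ofReal_le_ofReal (mul_le_of_le_one_right (S.rate_pos k).le ?_)
      exact Real.exp_le_one_iff.2 (by nlinarith [S.rate_pos k, hu.2])
    _ = ENNReal.ofReal (S.rate k) • volume.restrict (Ioc 0 t) := withDensity_const _
    _ ≤ _ := by
      gcongr
      exact Ioc_subset_Icc_self.trans (Icc_subset_Icc_right ht)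
  exact Integrable.mono_measure (hF.smul_measure ENNReal.ofReal_ne_top) hle

omit [NormedSpace ℝ E] in
-- On `(0, T]` the density is at least λe^{-λT} > 0, so integrability against it gives Lebesgue
-- integrability.
lemma integrableOn_of_remainingLaw (k : Mode d) {F : ℝ → E} {T : ℝ}
    (hF : Integrable F (S.remainingLaw k T)) : IntegrableOn F (Icc 0 T) := by
  set c := S.rate k * Real.exp (-(S.rate k * T)) with hc
  have hc0 : 0 < c := mul_pos (S.rate_pos k) (Real.exp_pos _)
  have hle : ENNReal.ofReal c • volume.restrict (Ioc 0 T) ≤ S.remainingLaw k T := by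
    rw [← withDensity_const]
    refine withDensity_mono ?_
    filter_upwards [ae_restrict_mem measurableSet_Ioc] with u hu
    refine ENNReal.ofReal_le_ofReal (mul_le_mul_of_nonneg_left ?_ (S.rate_pos k).le)
    exact Real.exp_le_exp.2 (by nlinarith [S.rate_pos k, hu.1])
  rw [integrableOn_Icc_iff_integrableOn_Ioc, IntegrableOn]
  exact (integrable_smul_measure (ENNReal.ofReal_pos.2 hc0).ne' ENNReal.ofReal_ne_top).1
    (hF.mono_measure hle)

end Bochner

/-! ### Estimates for the bracket -/

lemma lbracket_mono {g M N : Mode d → ℝ → ℝ≥0∞} {u : ℝ} (h : ∀ k, N k u ≤ M k u) (k : Mode d) :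
    S.lbracket g N k u ≤ S.lbracket g M k u := by
  unfold lbracket
  gcongr with lm
  · exact h k
  · exact h lm.1
  · exact h lm.2

/-- All terms increase with the index, so the two factors of a product can be moved to the larger of
their indices, and suprema commute with sums. -/
lemma lbracket_iSup_le {g : Mode d → ℝ → ℝ≥0∞} {M : ℕ → Mode d → ℝ → ℝ≥0∞} {u : ℝ}
    (h : ∀ k, Monotone fun n => M n k u) (k : Mode d) :
    S.lbracket g (fun k s => ⨆ n, M n k s) k u ≤ ⨆ n, S.lbracket g (M n) k u := by
  have hmul : ∀ l m, (⨆ n, M n l u) * (⨆ n, M n m u) ≤ ⨆ n, M n l u * M n m u := by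
    intro l m
    rw [ENNReal.iSup_mul]
    refine iSup_le fun i => ?_
    rw [ENNReal.mul_iSup]
    refine iSup_le fun j => le_iSup_of_le (max i j) ?_
    exact mul_le_mul' (h l (le_max_left _ _)) (h m (le_max_right _ _))
  have hmono : ∀ lm : Mode d × Mode d, Monotone fun n =>
      ENNReal.ofReal (S.Cb * S.q k lm.1 lm.2) * (M n lm.1 u * M n lm.2 u) := fun lm i j hij =>
    mul_le_mul_right (mul_le_mul' (h _ hij) (h _ hij)) _
  have hsum : ∑' lm : Mode d × Mode d, ENNReal.ofReal (S.Cb * S.q k lm.1 lm.2)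
        * ((⨆ n, M n lm.1 u) * (⨆ n, M n lm.2 u))
      ≤ ⨆ n, ∑' lm : Mode d × Mode d, ENNReal.ofReal (S.Cb * S.q k lm.1 lm.2)
        * (M n lm.1 u * M n lm.2 u) := by
    rw [ENNReal.tsum_eq_iSup_sum]
    refine iSup_le fun s => ?_
    calc _ ≤ ∑ lm ∈ s, ⨆ n, ENNReal.ofReal (S.Cb * S.q k lm.1 lm.2)
          * (M n lm.1 u * M n lm.2 u) := by
          refine Finset.sum_le_sum fun lm _ => ?_
          rw [← ENNReal.mul_iSup]
          exact mul_le_mul_right (hmul _ _) _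
      _ = ⨆ n, ∑ lm ∈ s, ENNReal.ofReal (S.Cb * S.q k lm.1 lm.2)
          * (M n lm.1 u * M n lm.2 u) := ENNReal.finsetSum_iSup_of_monotone hmono
      _ ≤ _ := iSup_mono fun n => ENNReal.sum_le_tsum s
  unfold lbracket
  rw [ENNReal.mul_iSup]
  refine (add_le_add_left (add_le_add_right hsum _) _).trans ?_
  rw [ENNReal.iSup_add_iSup_of_monotone (fun i j hij => mul_le_mul_right (h k hij) _)
    (fun i j hij => ENNReal.tsum_le_tsum fun lm => hmono lm hij), ENNReal.iSup_add]

lemma measurable_lbracket {g M : Mode d → ℝ → ℝ≥0∞} (hg : ∀ k, Measurable (g k))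
    (hM : ∀ k, Measurable (M k)) (k : Mode d) : Measurable (S.lbracket g M k) := by
  have := hg k
  have := hM k
  unfold lbracket
  refine Measurable.add (Measurable.add (by fun_prop) ?_) (by fun_prop)
  refine Measurable.tsum fun lm => ?_
  have := hM lm.1
  have := hM lm.2
  fun_prop

section Bracket

variable {E : Type*} [NormedAddCommGroup E] [NormedSpace ℝ E]
  {B : Mode d → Mode d → Mode d → E →L[ℝ] E →L[ℝ] E}
  (hB : ∀ k l m x y, ‖B k l m x y‖ ≤ ‖x‖ * ‖y‖) {γ Z : Mode d → ℝ → E}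
  {M : Mode d → ℝ → ℝ≥0∞} {u : ℝ}

lemma enorm_smul_of_nonneg {c : ℝ} (hc : 0 ≤ c) (x : E) : ‖c • x‖ₑ = ENNReal.ofReal c * ‖x‖ₑ := by
  rw [enorm_smul, Real.enorm_of_nonneg hc]

lemma Cf_mul_p_nonneg (k : Mode d) : 0 ≤ S.Cf * S.p k := mul_nonneg S.Cf_nonneg (S.p_mem k).1

lemma Cb_mul_q_nonneg (k l m : Mode d) : 0 ≤ S.Cb * S.q k l m :=
  mul_nonneg S.Cb_nonneg (S.q_mem k l m).1

include hB

lemma enorm_bilin_le (k l m : Mode d) (x y : E) : ‖B k l m x y‖ₑ ≤ ‖x‖ₑ * ‖y‖ₑ := by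
  rw [← ofReal_norm, ← ofReal_norm, ← ofReal_norm, ← ENNReal.ofReal_mul (norm_nonneg _)]
  exact ENNReal.ofReal_le_ofReal (hB k l m x y)

lemma tsum_enorm_bilin_le (hZ : ∀ k, ‖Z k u‖ₑ ≤ M k u) (k : Mode d) :
    ∑' lm : Mode d × Mode d,
        ‖(S.Cb * S.q k lm.1 lm.2) • B k lm.1 lm.2 (Z lm.1 u) (Z lm.2 u)‖ₑ
      ≤ ∑' lm : Mode d × Mode d,
        ENNReal.ofReal (S.Cb * S.q k lm.1 lm.2) * (M lm.1 u * M lm.2 u) := by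
  refine ENNReal.tsum_le_tsum fun lm => ?_
  rw [enorm_smul_of_nonneg (S.Cb_mul_q_nonneg _ _ _)]
  gcongr
  exact (enorm_bilin_le hB _ _ _ _ _).trans (mul_le_mul' (hZ _) (hZ _))

lemma enorm_bracket_le (hZ : ∀ k, ‖Z k u‖ₑ ≤ M k u) (k : Mode d) :
    ‖S.bracket (fun k l m x y => B k l m x y) γ Z k u‖ₑ
      ≤ S.lbracket (fun k s => ‖γ k s‖ₑ) M k u := by
  unfold bracket lbracket
  refine (enorm_add_le _ _).trans (add_le_add ((enorm_add_le _ _).trans (add_le_add ?_ ?_)) ?_)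
  · rw [enorm_smul_of_nonneg (S.Cf_mul_p_nonneg k)]
    gcongr
    exact hZ k
  · exact enorm_tsum_le_tsum_enorm.trans (S.tsum_enorm_bilin_le hB hZ k)
  · rw [enorm_smul_of_nonneg (S.death_mem k).1]

variable [CompleteSpace E]

lemma summable_bilin {g : Mode d → ℝ → ℝ≥0∞} (hZ : ∀ k, ‖Z k u‖ₑ ≤ M k u) {k : Mode d}
    (hM : S.lbracket g M k u < ⊤) :
    Summable fun lm : Mode d × Mode d =>
      (S.Cb * S.q k lm.1 lm.2) • B k lm.1 lm.2 (Z lm.1 u) (Z lm.2 u) := by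
  refine Summable.of_enorm (ne_top_of_le_ne_top ?_ (S.tsum_enorm_bilin_le hB hZ k))
  unfold lbracket at hM
  exact (ENNReal.add_lt_top.1 (ENNReal.add_lt_top.1 hM).1).2.ne

/-- The heart of the argument. The gap |Z - Y| ≤ M - N passes through the bracket because B(z,z') -
B(y,y') = B(z-y,z') + B(y,z'-y') is at most (M-N)M' + N(M'-N') = MM' - NN'. The forcing terms cancel
on the left. The additive form remains meaningful in `[0, ∞]`. -/
lemma enorm_bracket_sub_add_le {Y : Mode d → ℝ → E} {N : Mode d → ℝ → ℝ≥0∞}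
    (hZ : ∀ k, ‖Z k u‖ₑ ≤ M k u) (hY : ∀ k, ‖Y k u‖ₑ ≤ N k u)
    (hZY : ∀ k, ‖Z k u - Y k u‖ₑ + N k u ≤ M k u) {k : Mode d}
    (hM : S.lbracket (fun k s => ‖γ k s‖ₑ) M k u < ⊤) :
    ‖S.bracket (fun k l m x y => B k l m x y) γ Z k u
        - S.bracket (fun k l m x y => B k l m x y) γ Y k u‖ₑ
      + S.lbracket (fun k s => ‖γ k s‖ₑ) N k u ≤ S.lbracket (fun k s => ‖γ k s‖ₑ) M k u := by
  have hNM : ∀ k, N k u ≤ M k u := fun k => le_add_self.trans (hZY k)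
  have sZ := S.summable_bilin hB hZ hM
  have sY := S.summable_bilin hB hY ((S.lbracket_mono hNM k).trans_lt hM)
  have e : S.bracket (fun k l m x y => B k l m x y) γ Z k u
        - S.bracket (fun k l m x y => B k l m x y) γ Y k u
      = (S.Cf * S.p k) • (Z k u - Y k u) + ∑' lm : Mode d × Mode d, (S.Cb * S.q k lm.1 lm.2) •
        (B k lm.1 lm.2 (Z lm.1 u) (Z lm.2 u) - B k lm.1 lm.2 (Y lm.1 u) (Y lm.2 u)) := by
    simp only [smul_sub]
    rw [sZ.tsum_sub sY, bracket, bracket]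
    abel
  have hterm : ∀ l m, ‖B k l m (Z l u) (Z m u) - B k l m (Y l u) (Y m u)‖ₑ + N l u * N m u
      ≤ M l u * M m u := fun l m => calc
    _ = ‖B k l m (Z l u - Y l u) (Z m u) + B k l m (Y l u) (Z m u - Y m u)‖ₑ + N l u * N m u := by
      congr 2
      simp
    _ ≤ (‖Z l u - Y l u‖ₑ * M m u + N l u * ‖Z m u - Y m u‖ₑ) + N l u * N m u := by
      gcongr
      refine (enorm_add_le _ _).trans (add_le_add ?_ ?_)
      · exact (enorm_bilin_le hB _ _ _ _ _).trans (mul_le_mul_right (hZ m) _)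
      · exact (enorm_bilin_le hB _ _ _ _ _).trans (mul_le_mul_left (hY l) _)
    _ = ‖Z l u - Y l u‖ₑ * M m u + N l u * (‖Z m u - Y m u‖ₑ + N m u) := by ring
    _ ≤ ‖Z l u - Y l u‖ₑ * M m u + N l u * M m u := by gcongr; exact hZY m
    _ = (‖Z l u - Y l u‖ₑ + N l u) * M m u := by ring
    _ ≤ _ := by gcongr; exact hZY l
  rw [e]
  calc _ ≤ (ENNReal.ofReal (S.Cf * S.p k) * ‖Z k u - Y k u‖ₑ
        + ∑' lm : Mode d × Mode d, ENNReal.ofReal (S.Cb * S.q k lm.1 lm.2)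
          * ‖B k lm.1 lm.2 (Z lm.1 u) (Z lm.2 u) - B k lm.1 lm.2 (Y lm.1 u) (Y lm.2 u)‖ₑ)
        + S.lbracket (fun k s => ‖γ k s‖ₑ) N k u := by
        gcongr
        refine (enorm_add_le _ _).trans (add_le_add ?_ (enorm_tsum_le_tsum_enorm.trans ?_))
        · rw [enorm_smul_of_nonneg (S.Cf_mul_p_nonneg k)]
        · exact ENNReal.tsum_le_tsum fun lm => by
            rw [enorm_smul_of_nonneg (S.Cb_mul_q_nonneg _ _ _)]
    _ = ENNReal.ofReal (S.Cf * S.p k) * (‖Z k u - Y k u‖ₑ + N k u)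
        + ∑' lm : Mode d × Mode d, ENNReal.ofReal (S.Cb * S.q k lm.1 lm.2)
          * (‖B k lm.1 lm.2 (Z lm.1 u) (Z lm.2 u) - B k lm.1 lm.2 (Y lm.1 u) (Y lm.2 u)‖ₑ
            + N lm.1 u * N lm.2 u)
        + ENNReal.ofReal (S.death k) * ‖γ k u‖ₑ := by
        simp only [mul_add, ENNReal.tsum_add, lbracket]
        ring
    _ ≤ _ := by
        unfold lbracket
        gcongr with lm
        · exact hZY k
        · exact hterm _ _

omit hB [CompleteSpace E] in
-- The only delicate term is the infinite sum, an almost everywhere limit of its finite partial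
-- sums.
lemma aestronglyMeasurable_bracket [MeasurableSpace E] [BorelSpace E] [SecondCountableTopology E]
    (hγ : ∀ k, Measurable (γ k)) {μ : Measure ℝ} (hZ : ∀ k, AEStronglyMeasurable (Z k) μ)
    {k : Mode d} (hs : ∀ᵐ u ∂μ, Summable fun lm : Mode d × Mode d =>
      (S.Cb * S.q k lm.1 lm.2) • B k lm.1 lm.2 (Z lm.1 u) (Z lm.2 u)) :
    AEStronglyMeasurable (S.bracket (fun k l m x y => B k l m x y) γ Z k) μ := by
  have hterm : ∀ lm : Mode d × Mode d, AEStronglyMeasurable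
      (fun u => (S.Cb * S.q k lm.1 lm.2) • B k lm.1 lm.2 (Z lm.1 u) (Z lm.2 u)) μ := fun lm => by
    have : Continuous fun x : E × E => B k lm.1 lm.2 x.1 x.2 := by fun_prop
    exact (this.comp_aestronglyMeasurable ((hZ lm.1).prodMk (hZ lm.2))).const_smul _
  have hsum : AEStronglyMeasurable (fun u => ∑' lm : Mode d × Mode d,
      (S.Cb * S.q k lm.1 lm.2) • B k lm.1 lm.2 (Z lm.1 u) (Z lm.2 u)) μ := by
    refine aestronglyMeasurable_of_tendsto_ae (atTop : Filter (Finset (Mode d × Mode d)))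
      (f := fun s u => ∑ lm ∈ s,
        (S.Cb * S.q k lm.1 lm.2) • B k lm.1 lm.2 (Z lm.1 u) (Z lm.2 u)) (fun s => ?_) ?_
    · exact Finset.aestronglyMeasurable_fun_sum s fun lm _ => hterm lm
    · filter_upwards [hs] with u hu
      exact hu.hasSum
  exact (((hZ k).const_smul _).add hsum).add ((hγ k).aestronglyMeasurable.const_smul _)

end Bracket

/-! ### Minimality of the comparison expectation -/

section Limits

variable {E : Type*} [NormedAddCommGroup E] {χ₀ : Mode d → E} {γ : Mode d → ℝ → E}

/-- The increasing limit of the comparison expectations along finitely many generations. It is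
`comparisonExpectation` at nonnegative times. -/
def normMeanLimit (χ₀ : Mode d → E) (γ : Mode d → ℝ → E) (k : Mode d) (t : ℝ) : ℝ≥0∞ :=
  ⨆ n, S.normMean χ₀ γ n k t

lemma le_normMeanLimit (n : ℕ) (k : Mode d) (t : ℝ) :
    S.normMean χ₀ γ n k t ≤ S.normMeanLimit χ₀ γ k t :=
  le_iSup (fun n => S.normMean χ₀ γ n k t) n

lemma normMean_zero (k : Mode d) (t : ℝ) : S.normMean χ₀ γ 0 k t = 0 := by
  simp [lmean, approxAt, evalApprox]

variable [MeasurableSpace E] [BorelSpace E] (hγ : ∀ k, Measurable (γ k))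
include hγ

lemma measurable_normMean (n : ℕ) (k : Mode d) : Measurable (S.normMean χ₀ γ n k) :=
  ((S.measurable_approxAt (B := fun _ _ _ x y => x * y) (fun _ _ _ => by fun_prop)
    (fun k => (hγ k).norm) n k).ennreal_ofReal).lintegral_prod_right'

lemma measurable_normMeanLimit (k : Mode d) : Measurable (S.normMeanLimit χ₀ γ k) :=
  Measurable.iSup fun n => S.measurable_normMean hγ n k

lemma normMean_succ (n : ℕ) (k : Mode d) {t : ℝ} (ht : 0 ≤ t) :
    S.normMean χ₀ γ (n + 1) k t = ENNReal.ofReal (Real.exp (-(S.rate k * t))) * ‖χ₀ k‖ₑ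
      + ∫⁻ u, S.lbracket (fun k s => ‖γ k s‖ₑ) (S.normMean χ₀ γ n) k u ∂S.remainingLaw k t := by
  rw [normMean, S.lmean_succ (fun _ => norm_nonneg _) (fun _ _ => norm_nonneg _)
    (fun k => (hγ k).norm), mildLIntegral_eq _ _ _ _ ht]
  simp only [ofReal_norm]

/-- Let `n` tend to infinity in the Picard recursion by monotone convergence. Equality is not needed
below: a supersolution suffices to propagate the gap. -/
lemma mild_normMeanLimit_le (k : Mode d) {t : ℝ} (ht : 0 ≤ t) :
    ENNReal.ofReal (Real.exp (-(S.rate k * t))) * ‖χ₀ k‖ₑ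
      + ∫⁻ u, S.lbracket (fun k s => ‖γ k s‖ₑ) (S.normMeanLimit χ₀ γ) k u ∂S.remainingLaw k t
      ≤ S.normMeanLimit χ₀ γ k t := by
  calc _ ≤ ENNReal.ofReal (Real.exp (-(S.rate k * t))) * ‖χ₀ k‖ₑ
      + ∫⁻ u, ⨆ n, S.lbracket (fun k s => ‖γ k s‖ₑ) (S.normMean χ₀ γ n) k u
          ∂S.remainingLaw k t := by
        gcongr with u
        exact S.lbracket_iSup_le (fun k => S.normMean_mono χ₀ γ k u) k
    _ = ⨆ n, S.normMean χ₀ γ (n + 1) k t := by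
        rw [lintegral_iSup
          (fun n => S.measurable_lbracket (fun k => (hγ k).enorm) (S.measurable_normMean hγ n) k)
          (fun i j hij u => S.lbracket_mono (fun k => S.normMean_mono χ₀ γ k u hij) k),
          ENNReal.add_iSup]
        simp only [S.normMean_succ hγ _ k ht]
    _ ≤ _ := iSup_le fun n => S.le_normMeanLimit (n + 1) k t

/-- A finite mild solution of the comparison equation dominates the comparison expectation. -/
lemma normMeanLimit_le_of_comparisonSolution [NormedSpace ℝ E] {T : ℝ} {X : Mode d → ℝ → ℝ}
    (hX : S.IsComparisonSolution χ₀ γ T X) (k : Mode d) {t : ℝ} (ht : t ∈ Icc 0 T) :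
    S.normMeanLimit χ₀ γ k t ≤ ENNReal.ofReal (X k t) := by
  obtain ⟨hX0, hX⟩ := hX
  refine iSup_le fun n => ?_
  -- The iterates start from zero, and the comparison mild map is monotone and fixes `X`, so every
  -- iterate stays below `X`.
  induction n generalizing k t with
  | zero => simp [normMean_zero]
  | succ n ih =>
    set br := S.bracket (fun _ _ _ x y : _ => x * y) (fun k s => ‖γ k s‖) X k with hbr
    have hmem : ∀ᵐ u ∂S.remainingLaw k t, u ∈ Icc 0 T := by
      filter_upwards [S.ae_remainingLaw_mem k t] with u hu
      exact ⟨hu.1.le, hu.2.trans ht.2⟩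
    have hterm : ∀ u ∈ Icc 0 T, ∀ lm : Mode d × Mode d,
        0 ≤ (S.Cb * S.q k lm.1 lm.2) • (X lm.1 u * X lm.2 u) := fun u hu lm =>
      mul_nonneg (S.Cb_mul_q_nonneg _ _ _) (mul_nonneg (hX0 _ u hu) (hX0 _ u hu))
    have hbr0 : ∀ u ∈ Icc 0 T, 0 ≤ br u := fun u hu =>
      add_nonneg (add_nonneg (mul_nonneg (S.Cf_mul_p_nonneg k) (hX0 k u hu))
        (tsum_nonneg (hterm u hu))) (mul_nonneg (S.death_mem k).1 (norm_nonneg _))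
    have hi : Integrable br (S.remainingLaw k t) :=
      S.integrable_remainingLaw k ht.2 (hX.integrable k)
    have hle : ∫⁻ u, S.lbracket (fun k s => ‖γ k s‖ₑ) (S.normMean χ₀ γ n) k u ∂S.remainingLaw k t
        ≤ ENNReal.ofReal (∫ u, br u ∂S.remainingLaw k t) := by
      rw [ofReal_integral_eq_lintegral_ofReal hi (hmem.mono hbr0)]
      refine lintegral_mono_ae ?_
      filter_upwards [hmem, (S.remainingLaw_absolutelyContinuous k ht.2).ae_le (hX.summable k)]
        with u hu hs
      refine (S.lbracket_mono (M := fun k u => ENNReal.ofReal (X k u))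
        (fun k => ih k hu) k).trans_eq ?_
      have t1 : 0 ≤ (S.Cf * S.p k) • X k u := mul_nonneg (S.Cf_mul_p_nonneg k) (hX0 k u hu)
      have t3 : 0 ≤ S.death k • ‖γ k u‖ := mul_nonneg (S.death_mem k).1 (norm_nonneg _)
      rw [hbr, bracket, ENNReal.ofReal_add (add_nonneg t1 (tsum_nonneg (hterm u hu))) t3,
        ENNReal.ofReal_add t1 (tsum_nonneg (hterm u hu)),
        ENNReal.ofReal_tsum_of_nonneg (hterm u hu) hs, lbracket]
      simp only [smul_eq_mul]
      rw [ENNReal.ofReal_mul (S.Cf_mul_p_nonneg k), ENNReal.ofReal_mul (S.death_mem k).1,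
        ofReal_norm]
      congr 2
      refine tsum_congr fun lm => ?_
      rw [ENNReal.ofReal_mul (S.Cb_mul_q_nonneg _ _ _), ENNReal.ofReal_mul (hX0 _ u hu)]
    have t1 : 0 ≤ Real.exp (-(S.rate k * t)) • ‖χ₀ k‖ :=
      mul_nonneg (Real.exp_pos _).le (norm_nonneg _)
    rw [S.normMean_succ hγ n k ht.1, hX.mild k t ht, ← S.integral_remainingLaw k _ ht.1, ← hbr,
      ENNReal.ofReal_add t1 (integral_nonneg_of_ae (hmem.mono hbr0)), smul_eq_mul,
      ENNReal.ofReal_mul (Real.exp_pos _).le, ofReal_norm]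
    gcongr

end Limits

/-! ### The gap estimate, existence and uniqueness -/

section Main

variable {E : Type*} [NormedAddCommGroup E] [NormedSpace ℝ E] [CompleteSpace E]
  [MeasurableSpace E] [BorelSpace E] [SecondCountableTopology E]
  {B : Mode d → Mode d → Mode d → E →L[ℝ] E →L[ℝ] E}
  (hB : ∀ k l m x y, ‖B k l m x y‖ ≤ ‖x‖ * ‖y‖) {χ₀ : Mode d → E} {γ : Mode d → ℝ → E}
  (hγ : ∀ k, Measurable (γ k)) {T : ℝ}

omit [CompleteSpace E] [MeasurableSpace E] [BorelSpace E] [SecondCountableTopology E] in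
lemma mean_zero (k : Mode d) (t : ℝ) :
    S.mean (fun k l m x y => B k l m x y) χ₀ γ 0 k t = 0 := by
  simp [mean, approxAt, evalApprox]

omit [CompleteSpace E] in
include hγ in
lemma measurable_mean (n : ℕ) (k : Mode d) :
    Measurable (S.mean (fun k l m x y => B k l m x y) χ₀ γ n k) :=
  ((S.measurable_approxAt (B := fun k l m x y => B k l m x y)
    (fun _ _ _ => measurable_bilin _) hγ n k).stronglyMeasurable.integral_prod_right').measurable

variable (hfin : ∀ k, ∀ t ∈ Icc 0 T, S.normMeanLimit χ₀ γ k t < ⊤)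
include hγ hfin

omit [NormedSpace ℝ E] [CompleteSpace E] [SecondCountableTopology E] in
lemma lintegral_lbracket_lt_top (k : Mode d) {t : ℝ} (ht : t ∈ Icc 0 T) :
    ∫⁻ u, S.lbracket (fun k s => ‖γ k s‖ₑ) (S.normMeanLimit χ₀ γ) k u ∂S.remainingLaw k t < ⊤ :=
  (le_add_self.trans (S.mild_normMeanLimit_le hγ k ht.1)).trans_lt (hfin k t ht)

omit [NormedSpace ℝ E] [CompleteSpace E] [SecondCountableTopology E] in
-- Finiteness of the limit at time `T` bounds the integral of its bracket over the remaining time,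
-- hence the bracket at almost every time in `[0, T]`.
lemma ae_lbracket_lt_top (hT : 0 ≤ T) (k : Mode d) : ∀ᵐ u ∂volume.restrict (Icc 0 T),
    S.lbracket (fun k s => ‖γ k s‖ₑ) (S.normMeanLimit χ₀ γ) k u < ⊤ :=
  (S.absolutelyContinuous_remainingLaw k T).ae_le (ae_lt_top
    (S.measurable_lbracket (fun k => (hγ k).enorm) (S.measurable_normMeanLimit hγ) k)
    (S.lintegral_lbracket_lt_top hγ hfin k ⟨hT, le_rfl⟩).ne)

include hB

omit [SecondCountableTopology E] in
lemma ae_summable_bilin (hT : 0 ≤ T) {Z : Mode d → ℝ → E}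
    (hZ : ∀ k, ∀ t ∈ Icc 0 T, ‖Z k t‖ₑ ≤ S.normMeanLimit χ₀ γ k t) (k : Mode d) :
    ∀ᵐ s ∂volume.restrict (Icc 0 T), Summable fun lm : Mode d × Mode d =>
      (S.Cb * S.q k lm.1 lm.2) • B k lm.1 lm.2 (Z lm.1 s) (Z lm.2 s) := by
  filter_upwards [S.ae_lbracket_lt_top hγ hfin hT k, ae_restrict_mem measurableSet_Icc]
    with u hu hmem
  exact S.summable_bilin hB (fun k => hZ k u hmem) hu

/-- The bracket of a dominated family is dominated by the comparison bracket of the limit, whose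
weighted integral up to `T` is finite. -/
lemma integrableOn_bracket (hT : 0 ≤ T) {Z : Mode d → ℝ → E}
    (hZm : ∀ k, AEStronglyMeasurable (Z k) (volume.restrict (Icc 0 T)))
    (hZ : ∀ k, ∀ t ∈ Icc 0 T, ‖Z k t‖ₑ ≤ S.normMeanLimit χ₀ γ k t) (k : Mode d) :
    IntegrableOn (S.bracket (fun k l m x y => B k l m x y) γ Z k) (Icc 0 T) := by
  refine S.integrableOn_of_remainingLaw k ⟨?_, ?_⟩
  · exact (S.aestronglyMeasurable_bracket hγ hZm (S.ae_summable_bilin hB hγ hfin hT hZ k)).mono_ac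
      (S.remainingLaw_absolutelyContinuous k le_rfl)
  · refine (lintegral_mono_ae ?_).trans_lt
      (S.lintegral_lbracket_lt_top hγ hfin k (t := T) ⟨hT, le_rfl⟩)
    filter_upwards [S.ae_remainingLaw_mem k T] with u hu
    exact S.enorm_bracket_le hB (fun k => hZ k u ⟨hu.1.le, hu.2⟩) k

lemma mean_succ_eq (hT : 0 ≤ T) (n : ℕ) (k : Mode d) {t : ℝ} (ht : t ∈ Icc 0 T) :
    S.mean (fun k l m x y => B k l m x y) χ₀ γ (n + 1) k t
      = Real.exp (-(S.rate k * t)) • χ₀ k + ∫ u, S.bracket (fun k l m x y => B k l m x y) γ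
          (S.mean (fun k l m x y => B k l m x y) χ₀ γ n) k u ∂S.remainingLaw k t := by
  have hc : ∀ k, ∀ u ∈ Icc 0 T, S.comparisonExpectation χ₀ γ k u < ⊤ := fun k u hu => by
    rw [← S.iSup_normMean hγ k hu.1]
    exact hfin k u hu
  rw [S.mean_succ hγ
    (fun k u hu => S.integrable_approxAt hγ hB n k hu.1 (hc k u ⟨hu.1, hu.2.trans ht.2⟩))
    (S.integrable_approxAt hγ hB (n + 1) k ht.1 (hc k t ht))]
  refine S.mildIntegral_eq k (χ₀ k) ht.1 (S.integrable_remainingLaw k ht.2 ?_)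
  exact S.integrableOn_bracket hB hγ hfin hT
    (fun k => (S.measurable_mean hγ n k).aestronglyMeasurable)
    (fun k t _ => (S.enorm_mean_le hB n k t).trans (S.le_normMeanLimit n k t)) k

/-- The distance between two mild evolutions is controlled by the gap in the comparison
expectations. -/
lemma enorm_mild_sub_mean_add_le (hT : 0 ≤ T) {Z : Mode d → ℝ → E}
    (hZi : ∀ k, IntegrableOn (S.bracket (fun k l m x y => B k l m x y) γ Z k) (Icc 0 T))
    (hZ : ∀ k, ∀ t ∈ Icc 0 T, ‖Z k t‖ₑ ≤ S.normMeanLimit χ₀ γ k t) {n : ℕ}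
    (hn : ∀ k, ∀ t ∈ Icc 0 T, ‖Z k t - S.mean (fun k l m x y => B k l m x y) χ₀ γ n k t‖ₑ
      + S.normMean χ₀ γ n k t ≤ S.normMeanLimit χ₀ γ k t) (k : Mode d) {t : ℝ}
    (ht : t ∈ Icc 0 T) :
    ‖Real.exp (-(S.rate k * t)) • χ₀ k
        + ∫ u, S.bracket (fun k l m x y => B k l m x y) γ Z k u ∂S.remainingLaw k t
        - S.mean (fun k l m x y => B k l m x y) χ₀ γ (n + 1) k t‖ₑ
      + S.normMean χ₀ γ (n + 1) k t ≤ S.normMeanLimit χ₀ γ k t := by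
  set Y := S.mean (fun k l m x y => B k l m x y) χ₀ γ n with hY
  have hYle : ∀ k t, ‖Y k t‖ₑ ≤ S.normMean χ₀ γ n k t := S.enorm_mean_le hB n
  have hYi := S.integrableOn_bracket hB hγ hfin hT (Z := Y)
    (fun k => (S.measurable_mean hγ n k).aestronglyMeasurable)
    (fun k t _ => (hYle k t).trans (S.le_normMeanLimit n k t)) k
  -- The initial terms cancel in the vector-valued difference but remain in the comparison iterate,
  -- where the supersolution inequality for the limit uses them.
  rw [S.mean_succ_eq hB hγ hfin hT n k ht, add_sub_add_left_eq_sub,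
    ← integral_sub (S.integrable_remainingLaw k ht.2 (hZi k)) (S.integrable_remainingLaw k ht.2 hYi),
    S.normMean_succ hγ n k ht.1]
  have hN := S.measurable_lbracket (fun k => (hγ k).enorm)
    (S.measurable_normMean (χ₀ := χ₀) hγ n) k
  have hac := S.remainingLaw_absolutelyContinuous k ht.2
  calc _ ≤ ∫⁻ u, ‖S.bracket (fun k l m x y => B k l m x y) γ Z k u
          - S.bracket (fun k l m x y => B k l m x y) γ Y k u‖ₑ ∂S.remainingLaw k t
        + (ENNReal.ofReal (Real.exp (-(S.rate k * t))) * ‖χ₀ k‖ₑ + ∫⁻ u, S.lbracket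
          (fun k s => ‖γ k s‖ₑ) (S.normMean χ₀ γ n) k u ∂S.remainingLaw k t) := by
        gcongr
        exact enorm_integral_le_lintegral_enorm _
    _ = ENNReal.ofReal (Real.exp (-(S.rate k * t))) * ‖χ₀ k‖ₑ
        + ∫⁻ u, ‖S.bracket (fun k l m x y => B k l m x y) γ Z k u
          - S.bracket (fun k l m x y => B k l m x y) γ Y k u‖ₑ
          + S.lbracket (fun k s => ‖γ k s‖ₑ) (S.normMean χ₀ γ n) k u ∂S.remainingLaw k t := by
        rw [lintegral_add_right _ hN]
        ring
    _ ≤ ENNReal.ofReal (Real.exp (-(S.rate k * t))) * ‖χ₀ k‖ₑ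
        + ∫⁻ u, S.lbracket (fun k s => ‖γ k s‖ₑ) (S.normMeanLimit χ₀ γ) k u
          ∂S.remainingLaw k t := by
        refine add_le_add_right (lintegral_mono_ae ?_) _
        filter_upwards [hac.ae_le (S.ae_lbracket_lt_top hγ hfin hT k),
          hac.ae_le (ae_restrict_mem measurableSet_Icc)] with u hu hmem
        exact S.enorm_bracket_sub_add_le hB (fun k => hZ k u hmem) (fun k => hYle k u)
          (fun k => hn k u hmem) hu
    _ ≤ _ := S.mild_normMeanLimit_le hγ k ht.1

/-- Induction on `n` with the lag `j` fixed: the mild map advances both iterates by one, and for `n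
= 0` the claim is the bound on the iterate `j`. -/
lemma enorm_mean_sub_mean_add_le (hT : 0 ≤ T) (n j : ℕ) (k : Mode d) {t : ℝ} (ht : t ∈ Icc 0 T) :
    ‖S.mean (fun k l m x y => B k l m x y) χ₀ γ (n + j) k t
        - S.mean (fun k l m x y => B k l m x y) χ₀ γ n k t‖ₑ
      + S.normMean χ₀ γ n k t ≤ S.normMeanLimit χ₀ γ k t := by
  have hle : ∀ n k t, ‖S.mean (fun k l m x y => B k l m x y) χ₀ γ n k t‖ₑ
      ≤ S.normMeanLimit χ₀ γ k t := fun n k t =>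
    (S.enorm_mean_le hB n k t).trans (S.le_normMeanLimit n k t)
  induction n generalizing k t with
  | zero =>
    rw [mean_zero, sub_zero, normMean_zero, add_zero]
    exact hle _ _ _
  | succ n ih =>
    have := S.enorm_mild_sub_mean_add_le hB hγ hfin hT
      (S.integrableOn_bracket hB hγ hfin hT
        (fun k => (S.measurable_mean hγ (n + j) k).aestronglyMeasurable)
        (fun k t _ => hle (n + j) k t)) (fun k t _ => hle (n + j) k t)
      (fun k t ht => ih k ht) k ht
    rwa [← S.mean_succ_eq hB hγ hfin hT (n + j) k ht, show n + j + 1 = n + 1 + j by omega] at this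

omit hγ hB [CompleteSpace E] [BorelSpace E] [SecondCountableTopology E] [MeasurableSpace E] in
-- Finiteness of the limit allows subtraction: the distance is at most M - N_n, which tends to zero.
lemma tendsto_mean_of_enorm_sub_add_le {k : Mode d} {t : ℝ} (ht : t ∈ Icc 0 T) {z : E}
    (h : ∀ n, ‖z - S.mean (fun k l m x y => B k l m x y) χ₀ γ n k t‖ₑ + S.normMean χ₀ γ n k t
      ≤ S.normMeanLimit χ₀ γ k t) :
    Tendsto (fun n => S.mean (fun k l m x y => B k l m x y) χ₀ γ n k t) atTop (𝓝 z) := by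
  have hM : Tendsto (fun n => S.normMean χ₀ γ n k t) atTop (𝓝 (S.normMeanLimit χ₀ γ k t)) :=
    tendsto_atTop_iSup (S.normMean_mono χ₀ γ k t)
  have h0 : Tendsto (fun n => S.normMeanLimit χ₀ γ k t - S.normMean χ₀ γ n k t) atTop (𝓝 0) := by
    have := ENNReal.Tendsto.sub (tendsto_const_nhds (x := S.normMeanLimit χ₀ γ k t)) hM
      (Or.inl (hfin k t ht).ne)
    rwa [tsub_self] at this
  rw [tendsto_iff_edist_tendsto_0]
  refine tendsto_of_tendsto_of_tendsto_of_le_of_le tendsto_const_nhds h0 (fun _ => zero_le)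
    fun n => ?_
  rw [edist_comm, edist_eq_enorm_sub]
  exact ENNReal.le_sub_of_add_le_right
    ((S.le_normMeanLimit n k t).trans_lt (hfin k t ht)).ne (h n)

/-- Passing to the limit inside the bracket is avoided. The expectation inherits the gap
inequalities from the iterates, its image under the mild map satisfies them as well, and the limit
of the iterates is unique. -/
theorem expectation_isMildSolution (hT : 0 ≤ T) :
    S.IsMildSolution (fun k l m x y => B k l m x y) χ₀ γ T
      (S.expectation (fun k l m x y => B k l m x y) χ₀ γ) := by
  have hlim : ∀ k, ∀ t ∈ Icc 0 T, S.normMeanLimit χ₀ γ k t = S.comparisonExpectation χ₀ γ k t :=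
    fun k t ht => S.iSup_normMean hγ k ht.1
  have htend : ∀ k, ∀ t ∈ Icc 0 T, Tendsto
      (fun n => S.mean (fun k l m x y => B k l m x y) χ₀ γ n k t) atTop
      (𝓝 (S.expectation (fun k l m x y => B k l m x y) χ₀ γ k t)) := fun k t ht =>
    S.tendsto_mean hγ hB k ht.1 (by rw [← hlim k t ht]; exact hfin k t ht)
  have hZ : ∀ k, ∀ t ∈ Icc 0 T, ‖S.expectation (fun k l m x y => B k l m x y) χ₀ γ k t‖ₑ
      ≤ S.normMeanLimit χ₀ γ k t := fun k t ht =>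
    le_of_tendsto' (htend k t ht).enorm fun n =>
      (S.enorm_mean_le hB n k t).trans (S.le_normMeanLimit n k t)
  have hmeas : ∀ k, Measurable fun t : Icc 0 T =>
      S.expectation (fun k l m x y => B k l m x y) χ₀ γ k t := fun k =>
    measurable_of_tendsto_metrizable
      (f := fun n (t : Icc 0 T) => S.mean (fun k l m x y => B k l m x y) χ₀ γ n k t)
      (fun n => (S.measurable_mean hγ n k).comp measurable_subtype_coe)
      (tendsto_pi_nhds.2 fun t => htend k t t.2)
  have haes : ∀ k, AEStronglyMeasurable (S.expectation (fun k l m x y => B k l m x y) χ₀ γ k)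
      (volume.restrict (Icc 0 T)) := fun k =>
    aestronglyMeasurable_of_tendsto_ae atTop
      (fun n => (S.measurable_mean hγ n k).aestronglyMeasurable)
      (by filter_upwards [ae_restrict_mem measurableSet_Icc] with t ht using htend k t ht)
  have hint := S.integrableOn_bracket hB hγ hfin hT haes hZ
  have hgap : ∀ n k, ∀ t ∈ Icc 0 T, ‖S.expectation (fun k l m x y => B k l m x y) χ₀ γ k t
      - S.mean (fun k l m x y => B k l m x y) χ₀ γ n k t‖ₑ + S.normMean χ₀ γ n k t
        ≤ S.normMeanLimit χ₀ γ k t := by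
    intro n k t ht
    have h1 : Tendsto (fun j => S.mean (fun k l m x y => B k l m x y) χ₀ γ (n + j) k t) atTop
        (𝓝 (S.expectation (fun k l m x y => B k l m x y) χ₀ γ k t)) := by
      have := (tendsto_add_atTop_iff_nat n).2 (htend k t ht)
      simpa only [add_comm n] using this
    exact le_of_tendsto' ((h1.sub_const _).enorm.add_const _) fun j =>
      S.enorm_mean_sub_mean_add_le hB hγ hfin hT n j k ht
  refine ⟨hmeas, S.ae_summable_bilin hB hγ hfin hT hZ, hint, fun k t ht => ?_⟩
  rw [← S.integral_remainingLaw k _ ht.1]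
  refine tendsto_nhds_unique (htend k t ht)
    (S.tendsto_mean_of_enorm_sub_add_le hfin ht fun n => ?_)
  -- Propagation yields only the gaps of positive index. For index zero the claim is that the image
  -- W of the expectation is bounded by M, and it follows from index one: |W| ≤ |W - Y_1| + |Y_1| ≤
  -- |W - Y_1| + N_1 ≤ M.
  cases n with
  | zero =>
    have h1 := S.enorm_mild_sub_mean_add_le hB hγ hfin hT hint hZ (hgap 0) k ht
    rw [mean_zero, sub_zero, normMean_zero, add_zero]
    rw [zero_add] at h1
    refine le_trans ?_ ((add_le_add_right (S.enorm_mean_le hB 1 k t) _).trans h1)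
    exact (congrArg _ (sub_add_cancel _ _)).symm.trans_le (enorm_add_le _ _)
  | succ n => exact S.enorm_mild_sub_mean_add_le hB hγ hfin hT hint hZ (hgap n) k ht

/-- A mild solution is fixed by the mild map, so its gap inequalities follow by induction, starting
from the assumed domination by M. -/
theorem eq_expectation_of_isMildSolution (hT : 0 ≤ T) {χ' : Mode d → ℝ → E}
    (hχ' : S.IsMildSolution (fun k l m x y => B k l m x y) χ₀ γ T χ')
    (hle : ∀ k, ∀ t ∈ Icc 0 T, ‖χ' k t‖ₑ ≤ S.normMeanLimit χ₀ γ k t) (k : Mode d) {t : ℝ}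
    (ht : t ∈ Icc 0 T) : χ' k t = S.expectation (fun k l m x y => B k l m x y) χ₀ γ k t := by
  have hgap : ∀ n k, ∀ t ∈ Icc 0 T, ‖χ' k t
      - S.mean (fun k l m x y => B k l m x y) χ₀ γ n k t‖ₑ + S.normMean χ₀ γ n k t
        ≤ S.normMeanLimit χ₀ γ k t := by
    intro n
    induction n with
    | zero =>
      intro k t ht
      rw [mean_zero, sub_zero, normMean_zero, add_zero]
      exact hle k t ht
    | succ n ih =>
      intro k t ht
      rw [hχ'.mild k t ht, ← S.integral_remainingLaw k _ ht.1]
      exact S.enorm_mild_sub_mean_add_le hB hγ hfin hT hχ'.integrable hle ih k ht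
  refine tendsto_nhds_unique (S.tendsto_mean_of_enorm_sub_add_le hfin ht fun n => hgap n k t ht)
    (S.tendsto_mean hγ hB k ht.1 ?_)
  rw [← S.iSup_normMean hγ k ht.1]
  exact hfin k t ht

end Main

end Coeffs
end BranchingODE

end

theorem corollary4p3 {d r : ℕ} (S : BranchingODE.Coeffs d)
    (B : BranchingODE.Mode d → BranchingODE.Mode d → BranchingODE.Mode d →
      EuclideanSpace ℂ (Fin r) →ₗ[ℂ] EuclideanSpace ℂ (Fin r) →ₗ[ℂ] EuclideanSpace ℂ (Fin r))
    (hB : ∀ k l m x y, ‖B k l m x y‖ ≤ ‖x‖ * ‖y‖)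
    (χ₀ : BranchingODE.Mode d → EuclideanSpace ℂ (Fin r))
    (γ : BranchingODE.Mode d → ℝ → EuclideanSpace ℂ (Fin r))
    (hγ : ∀ k, Measurable (γ k))
    (T : ℝ) (hT : 0 ≤ T)
    (h : (∀ k, ∀ t ∈ Set.Icc 0 T, S.comparisonExpectation χ₀ γ k t < ⊤) ∨
      ∃ X : BranchingODE.Mode d → ℝ → ℝ, S.IsComparisonSolution χ₀ γ T X) :
    (∀ k, ∀ t ∈ Set.Icc 0 T,
      MeasureTheory.Integrable (S.eval (fun k l m x y => B k l m x y) χ₀ γ t) (S.treeLaw k)) ∧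
    S.IsMildSolution (fun k l m x y => B k l m x y) χ₀ γ T
      (S.expectation (fun k l m x y => B k l m x y) χ₀ γ) ∧
    (∀ k, ∀ t ∈ Set.Icc 0 T,
      ‖S.expectation (fun k l m x y => B k l m x y) χ₀ γ k t‖ₑ ≤
        S.comparisonExpectation χ₀ γ k t) ∧
    ∀ χ' : BranchingODE.Mode d → ℝ → EuclideanSpace ℂ (Fin r),
      S.IsMildSolution (fun k l m x y => B k l m x y) χ₀ γ T χ' →
      (∀ k, ∀ t ∈ Set.Icc 0 T, ‖χ' k t‖ₑ ≤ S.comparisonExpectation χ₀ γ k t) →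
      ∀ k, ∀ t ∈ Set.Icc 0 T,
        χ' k t = S.expectation (fun k l m x y => B k l m x y) χ₀ γ k t := by
  -- The argument uses only real bilinearity and continuity, so the complex bilinear maps are viewed
  -- over the reals; the norm bound supplies continuity with constant one.
  let B' : BranchingODE.Mode d → BranchingODE.Mode d → BranchingODE.Mode d →
      EuclideanSpace ℂ (Fin r) →L[ℝ] EuclideanSpace ℂ (Fin r) →L[ℝ] EuclideanSpace ℂ (Fin r) :=
    fun k l m => LinearMap.mkContinuous₂
      (LinearMap.mk₂ ℝ (fun x y => B k l m x y) (fun x x' y => by simp)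
        (fun c x y => by rw [LinearMap.map_smul_of_tower]; rfl) (fun x y y' => by simp)
        (fun c x y => by rw [LinearMap.map_smul_of_tower])) 1
      (fun x y => by simpa using hB k l m x y)
  have hB' : ∀ k l m x y, ‖B' k l m x y‖ ≤ ‖x‖ * ‖y‖ := hB
  -- Both alternatives enter only through finiteness of the limit of the comparison iterates.
  have hfin : ∀ k, ∀ t ∈ Set.Icc 0 T, S.normMeanLimit χ₀ γ k t < ⊤ := by
    rcases h with h | ⟨X, hX⟩
    · intro k t ht
      rw [BranchingODE.Coeffs.normMeanLimit, S.iSup_normMean hγ k ht.1]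
      exact h k t ht
    · exact fun k t ht =>
        (S.normMeanLimit_le_of_comparisonSolution hγ hX k ht).trans_lt ENNReal.ofReal_lt_top
  have hlim : ∀ k, ∀ t ∈ Set.Icc 0 T,
      S.normMeanLimit χ₀ γ k t = S.comparisonExpectation χ₀ γ k t :=
    fun k t ht => S.iSup_normMean hγ k ht.1
  refine ⟨fun k t ht => S.integrable_eval (B := B') hγ hB' k ht.1 (hlim k t ht ▸ hfin k t ht),
    S.expectation_isMildSolution (B := B') hB' hγ hfin hT, fun k t ht => ?_,
    fun χ' hχ' hle k t ht => ?_⟩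
  · exact (MeasureTheory.enorm_integral_le_lintegral_enorm _).trans
      (S.lintegral_enorm_eval_le (B := B') hB' k ht.1)
  · exact S.eq_expectation_of_isMildSolution (B := B') hB' hγ hfin hT hχ'
      (fun k t ht => (hle k t ht).trans_eq (hlim k t ht).symm) k ht
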